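/- Let $k$ be an algebraically closed field of characteristic $\neq 2$; varieties and algebraic groups are over $k$ (in the classical sense, i.e. reduced; varieties may be singular or reducible, groups need not be affine). Let $(D,G)$ be a group pair: $D$ is an algebraic group, $G\subset D$ a closed subgroup, and $\mathfrak d=\mathrm{Lie}(D)$ carries a nondegenerate symmetric $D$-invariant pairing $c$ for which $\mathfrak g=\mathrm{Lie}(G)$ is Lagrangian ($\mathfrak g=\mathfrak g^\perp$). Assume that $D/G$ is irreducible (for example, $D$ is connected). Here $D/G$ is the quotient variety, i.e. the homogeneous $D$-variety with a base point whose scheme-theoretic stabilizer is $G$ and whose orbit map $D\to D/G$ is smooth. For a group acting on a variety, the infinitesimal action of a Lie algebra element $x$ on functions is $(a(x).f)(y)=\frac{d}{dt}\big|_{t=0}f(\exp(-tx)y)$; write $a$ for the action of $\mathfrak g$ on a $G$-variety and $\tilde a$ for the action of $\mathfrak d$ on $D/G$. A Lagrangian complement is a subspace $\mathfrak h=\mathfrak h^\perp\subset\mathfrak d$ with $\mathfrak d=\mathfrak g\oplus\mathfrak h$; let $p_{\mathfrak h}\colon\mathfrak d^*\cong\mathfrak d\to\mathfrak g$ be the resulting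 projection and $j_{\mathfrak h}\colon\mathfrak g^*\cong\mathfrak h\subset\mathfrak d$ the isomorphism given by $c$. Let $\{x_i\}$ be a basis of $\mathfrak g$, $\{x^i\}$ the $c$-dual basis of $\mathfrak h$ and $r_{\mathfrak h}=\sum_i x^i\otimes x_i$. Put $\pi_D^{\mathfrak h}=r_{\mathfrak h}^R-r_{\mathfrak h}^L$ (difference of the right- and left-invariant tensors), let $\pi_G^{\mathfrak h}$ be the restriction of $\pi_D^{\mathfrak h}$ to $G$, and let $\phi^{\mathfrak h}\in\wedge^3\mathfrak g$ be $\phi^{\mathfrak h}(\alpha,\beta,\gamma)=c([j_{\mathfrak h}\alpha,j_{\mathfrak h}\beta],j_{\mathfrak h}\gamma)$. Two Lagrangian complements $\mathfrak h_1,\mathfrak h_2$ differ by the twist $t\in\wedge^2\mathfrak g$ if $p_{\mathfrak h_2}(\xi)-p_{\mathfrak h_1}(\xi)=-t(\xi|_{\mathfrak g},\cdot)$ for all $\xi\in\mathfrak d^*$. A quasi-Poisson $G$-variety is a $G$-variety $X$ with a bivector (skew-symmetric biderivation of $\mathcal O_X$) $\pi_X^{\mathfrak h}$, with bracket $\{\cdot,\cdot\}_{\mathfrak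 h}$, for every Lagrangian complement $\mathfrak h$, such that (i) the action map $G\times X\to X$ is compatible with the bivectors $\pi_G^{\mathfrak h}$ and $\pi_X^{\mathfrak h}$; (ii) $\frac12[\pi_X^{\mathfrak h},\pi_X^{\mathfrak h}]=a(\phi^{\mathfrak h})$, the left-hand side being $(f_1,f_2,f_3)\mapsto\{f_1,\{f_2,f_3\}\}+\{f_2,\{f_3,f_1\}\}+\{f_3,\{f_1,f_2\}\}$; (iii) $\pi_X^{\mathfrak h_2}=\pi_X^{\mathfrak h_1}-a(t)$ whenever $\mathfrak h_1,\mathfrak h_2$ differ by the twist $t$. Let $X$ be a quasi-Poisson $G$-variety and $\mu\colon X\to D/G$ a $G$-equivariant morphism. Then the following are equivalent. (1) For some Lagrangian complement $\mathfrak h$, and $\{e_i\}$ a basis of $\mathfrak d$ with dual basis $\{e^i\}$ of $\mathfrak d^*$, $$\{\mu^*f_1,f_2\}_{\mathfrak h}=\sum_i\mu^*(\tilde a(e_i).f_1)\cdot a(p_{\mathfrak h}(e^i)).f_2$$ for all local functions $f_1\in\mathcal O_{D/G}$, $f_2\in\mathcal O_X$. (2) (Alekseev--Kosmann-Schwarzbach.)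 For every open $U\subset D/G$ and every Lagrangian complement $\mathfrak h$ admissible on $U$ (that is, $\mathfrak h\to\mathfrak d\xrightarrow{\tilde a}\mathrm T_{D/G,s}$ is an isomorphism for all $s\in U$), one has $$a(x)=(\pi_X^{\mathfrak h})^\sharp(\mu^*\langle\theta^{\mathfrak h},x\rangle)\quad\text{on }\mu^{-1}(U)\text{ for every }x\in\mathfrak g.$$ Here $\theta^{\mathfrak h}\in\Omega^1(U;\mathfrak g^*)$ is defined by $\langle\theta^{\mathfrak h},x\rangle(\tilde a(y))=c(x,y)$ for $x\in\mathfrak g$, $y\in\mathfrak h$, and $\pi^\sharp(df).g=\{f,g\}$. -/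

import Mathlib

open Filter Topology

noncomputable section

namespace QuasiPoisson

set_option linter.unusedSectionVars false

/-! ### Spaces with functions and varieties -/

/-- A structure sheaf of `k`-valued functions on a topological space, given by saying which functions
are regular at which point.  The sections over an open `U` are the functions regular at every
point of `U`; values of a function away from the point under consideration are irrelevant. -/
class RegularFunctions (k : Type*) [Field k] (X : Type*) [TopologicalSpace X] where
  regAt : X → Subalgebra k (X → k)
  congr_near : ∀ {x : X} {f g : X → k}, f ∈ regAt x → f =ᶠ[𝓝 x] g → g ∈ regAt x
  eventually_reg : ∀ {x : X} {f : X → k}, f ∈ regAt x → ∀ᶠ y in 𝓝 x, f ∈ regAt y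
  inv_mem : ∀ {x : X} {f : X → k}, f ∈ regAt x → f x ≠ 0 → f⁻¹ ∈ regAt x
  eventually_ne : ∀ {x : X} {f : X → k}, f ∈ regAt x → f x ≠ 0 → ∀ᶠ y in 𝓝 x, f y ≠ 0

section Basic

variable (k : Type*) [Field k]
variable {X Y Z : Type*} [TopologicalSpace X] [RegularFunctions k X]
  [TopologicalSpace Y] [RegularFunctions k Y] [TopologicalSpace Z] [RegularFunctions k Z]

/-- The functions regular at `x`. -/
def regAt (x : X) : Subalgebra k (X → k) := RegularFunctions.regAt x

/-- The functions regular on `U`. -/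
def regOn (U : Set X) : Set (X → k) := {f | ∀ x ∈ U, f ∈ regAt k x}

/-- Morphisms of spaces with functions. -/
structure IsMorphism (φ : X → Y) : Prop where
  continuous : Continuous φ
  comp_mem : ∀ (x : X) (f : Y → k), f ∈ regAt k (φ x) → f ∘ φ ∈ regAt k x

/-- The induced structure on a subset (used for closed subgroups): a function is regular at a
point if near that point it is the restriction of a function regular on the ambient space. -/
instance instSubtype (p : X → Prop) : RegularFunctions k {x // p x} where
  regAt x :=
    { carrier := {f | ∃ F ∈ regAt k (x : X), ∀ᶠ y in 𝓝 x, f y = F y}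
      mul_mem' := by
        rintro f g ⟨F, hF, hf⟩ ⟨G, hG, hg⟩
        exact ⟨F * G, mul_mem hF hG, by filter_upwards [hf, hg] with y h1 h2; simp [h1, h2]⟩
      add_mem' := by
        rintro f g ⟨F, hF, hf⟩ ⟨G, hG, hg⟩
        exact ⟨F + G, add_mem hF hG, by filter_upwards [hf, hg] with y h1 h2; simp [h1, h2]⟩
      algebraMap_mem' := fun c =>
        ⟨algebraMap k _ c, Subalgebra.algebraMap_mem _ c, Eventually.of_forall fun y => rfl⟩ }
  congr_near := by
    rintro x f g ⟨F, hF, hf⟩ h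
    exact ⟨F, hF, by filter_upwards [hf, h] with y h1 h2; rw [← h2, h1]⟩
  eventually_reg := by
    rintro x f ⟨F, hF, hf⟩
    have h1 : ∀ᶠ y : {x // p x} in 𝓝 x, F ∈ regAt k (y : X) :=
      continuous_subtype_val.continuousAt.eventually (RegularFunctions.eventually_reg hF)
    filter_upwards [h1, hf.eventually_nhds] with y h2 h3
    exact ⟨F, h2, h3⟩
  inv_mem := by
    rintro x f ⟨F, hF, hf⟩ hx
    refine ⟨F⁻¹, RegularFunctions.inv_mem hF (by rwa [← hf.self_of_nhds]), ?_⟩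
    filter_upwards [hf] with y h1
    simp [h1]
  eventually_ne := by
    rintro x f ⟨F, hF, hf⟩ hx
    have h1 : ∀ᶠ y : {x // p x} in 𝓝 x, F (y : X) ≠ 0 :=
      continuous_subtype_val.continuousAt.eventually
        (RegularFunctions.eventually_ne hF (by rwa [← hf.self_of_nhds]))
    filter_upwards [h1, hf] with y h2 h3
    rwa [h3]

/-- The product of two spaces with functions; it does not carry the product topology. -/
def VProd (X Y : Type*) : Type _ := X × Y

/-- The subalgebra of functions on `X × Y` of the form `∑ i, u i x * v i y` with `u i`
regular on `U` and `v i` regular on `V`. -/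
def boxAlg (U : Set X) (V : Set Y) : Subalgebra k (X × Y → k) :=
  Algebra.adjoin k ({F | ∃ u ∈ regOn k U, F = fun p => u p.1} ∪
    {F | ∃ v ∈ regOn k V, F = fun p => v p.2})

theorem boxAlg_mono {U U' : Set X} {V V' : Set Y} (hU : U' ⊆ U) (hV : V' ⊆ V) :
    boxAlg k U V ≤ boxAlg k U' V' := by
  apply Algebra.adjoin_mono
  rintro F (⟨u, hu, rfl⟩ | ⟨v, hv, rfl⟩)
  · exact Or.inl ⟨u, fun x hx => hu x (hU hx), rfl⟩
  · exact Or.inr ⟨v, fun x hx => hv x (hV hx), rfl⟩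

/-- The basic open subsets of a product of varieties. -/
def basicOpens (X Y : Type*) [TopologicalSpace X] [RegularFunctions k X]
    [TopologicalSpace Y] [RegularFunctions k Y] : Set (Set (X × Y)) :=
  {W | ∃ (U : Set X) (V : Set Y) (b : X × Y → k), IsOpen U ∧ IsOpen V ∧ b ∈ boxAlg k U V ∧
    W = {p | p.1 ∈ U ∧ p.2 ∈ V ∧ b p ≠ 0}}

/-- The Zariski topology on the product. -/
@[reducible] def prodTopology (X Y : Type*) [TopologicalSpace X] [RegularFunctions k X]
    [TopologicalSpace Y] [RegularFunctions k Y] : TopologicalSpace (VProd X Y) :=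
  TopologicalSpace.generateFrom (basicOpens k X Y)

theorem isBasis_basicOpens : @TopologicalSpace.IsTopologicalBasis (VProd X Y)
    (prodTopology k X Y) (basicOpens k X Y) := by
  let _ := prodTopology k X Y
  refine ⟨?_, ?_, rfl⟩
  · rintro W ⟨U, V, b, hU, hV, hb, rfl⟩ W' ⟨U', V', b', hU', hV', hb', rfl⟩ p ⟨hp, hp'⟩
    refine ⟨_, ⟨U ∩ U', V ∩ V', b * b', hU.inter hU', hV.inter hV', ?_, rfl⟩,
      ⟨⟨hp.1, hp'.1⟩, ⟨hp.2.1, hp'.2.1⟩, mul_ne_zero hp.2.2 hp'.2.2⟩, ?_⟩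
    · exact mul_mem (boxAlg_mono k Set.inter_subset_left Set.inter_subset_left hb)
        (boxAlg_mono k Set.inter_subset_right Set.inter_subset_right hb')
    · rintro q ⟨h1, h2, h3⟩
      exact ⟨⟨h1.1, h2.1, left_ne_zero_of_mul h3⟩, ⟨h1.2, h2.2, right_ne_zero_of_mul h3⟩⟩
  · refine Set.eq_univ_of_forall fun p => ⟨_, ⟨Set.univ, Set.univ, 1, isOpen_univ, isOpen_univ,
      one_mem _, rfl⟩, trivial, trivial, one_ne_zero⟩

/-- `f` is regular at `p` as a function on the product: near `p` it is a quotient of functions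
`∑ i, u i x * v i y`. -/
def ProdRegAt (p : X × Y) (f : X × Y → k) : Prop :=
  ∃ (U : Set X) (V : Set Y) (a b : X × Y → k), IsOpen U ∧ IsOpen V ∧ p.1 ∈ U ∧ p.2 ∈ V ∧
    a ∈ boxAlg k U V ∧ b ∈ boxAlg k U V ∧ b p ≠ 0 ∧
    ∀ q : X × Y, q.1 ∈ U → q.2 ∈ V → b q ≠ 0 → f q = a q / b q

theorem ProdRegAt.op₂ {p : X × Y} {f g h : X × Y → k} (hf : ProdRegAt k p f)
    (hg : ProdRegAt k p g) (A : (X × Y → k) → (X × Y → k) → (X × Y → k) → (X × Y → k) → (X × Y → k))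
    (hA : ∀ (S : Subalgebra k (X × Y → k)), ∀ a ∈ S, ∀ b ∈ S, ∀ c ∈ S, ∀ d ∈ S, A a b c d ∈ S)
    (hh : ∀ a b c d q, b q ≠ 0 → d q ≠ 0 → f q = a q / b q → g q = c q / d q →
      h q = A a b c d q / (b q * d q)) : ProdRegAt k p h := by
  obtain ⟨U, V, a, b, hU, hV, h1, h2, ha, hb, hbp, hab⟩ := hf
  obtain ⟨U', V', c, d, hU', hV', h1', h2', hc, hd, hdp, hcd⟩ := hg
  have l := boxAlg_mono k (U := U) (V := V) (U' := U ∩ U') (V' := V ∩ V')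
    Set.inter_subset_left Set.inter_subset_left
  have r := boxAlg_mono k (U := U') (V := V') (U' := U ∩ U') (V' := V ∩ V')
    Set.inter_subset_right Set.inter_subset_right
  refine ⟨U ∩ U', V ∩ V', A a b c d, b * d, hU.inter hU', hV.inter hV', ⟨h1, h1'⟩, ⟨h2, h2'⟩,
    hA _ _ (l ha) _ (l hb) _ (r hc) _ (r hd), mul_mem (l hb) (r hd), mul_ne_zero hbp hdp, ?_⟩
  intro q hq1 hq2 hbd
  have e1 := left_ne_zero_of_mul hbd
  have e2 := right_ne_zero_of_mul hbd
  exact hh a b c d q e1 e2 (hab q hq1.1 hq2.1 e1) (hcd q hq1.2 hq2.2 e2)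

theorem eventually_prod_iff {p : VProd X Y} {P : VProd X Y → Prop} :
    (∀ᶠ q in @nhds _ (prodTopology k X Y) p, P q) ↔
      ∃ (U : Set X) (V : Set Y) (b : X × Y → k), IsOpen U ∧ IsOpen V ∧ b ∈ boxAlg k U V ∧
        p.1 ∈ U ∧ p.2 ∈ V ∧ b p ≠ 0 ∧ ∀ q : X × Y, q.1 ∈ U → q.2 ∈ V → b q ≠ 0 → P q := by
  let _ := prodTopology k X Y
  change {q | P q} ∈ 𝓝 p ↔ _
  rw [(isBasis_basicOpens k).mem_nhds_iff]
  constructor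
  · rintro ⟨W, ⟨U, V, b, hU, hV, hb, rfl⟩, ⟨h1, h2, h3⟩, h⟩
    exact ⟨U, V, b, hU, hV, hb, h1, h2, h3, fun q q1 q2 q3 => h ⟨q1, q2, q3⟩⟩
  · rintro ⟨U, V, b, hU, hV, hb, h1, h2, h3, h⟩
    exact ⟨_, ⟨U, V, b, hU, hV, hb, rfl⟩, ⟨h1, h2, h3⟩, fun q hq => h q hq.1 hq.2.1 hq.2.2⟩

/-- The structure of a product of two spaces with functions. -/
@[reducible] def prodRegularFunctions : @RegularFunctions k _ (VProd X Y) (prodTopology k X Y) :=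
  letI := prodTopology k X Y
  { regAt := fun p =>
      { carrier := {f | ProdRegAt k p f}
        mul_mem' := fun {f g} hf hg => hf.op₂ k hg (fun a _ c _ => a * c)
          (fun S a ha b hb c hc d hd => mul_mem ha hc)
          (fun a b c d q h1 h2 h3 h4 => by
            change f q * g q = a q * c q / _
            rw [h3, h4, div_mul_div_comm])
        add_mem' := fun {f g} hf hg => hf.op₂ k hg (fun a b c d => a * d + b * c)
          (fun S a ha b hb c hc d hd => add_mem (mul_mem ha hd) (mul_mem hb hc))
          (fun a b c d q h1 h2 h3 h4 => by
            change f q + g q = (a q * d q + b q * c q) / _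
            rw [h3, h4, div_add_div _ _ h1 h2])
        algebraMap_mem' := fun c => ⟨Set.univ, Set.univ, algebraMap k _ c, 1, isOpen_univ,
          isOpen_univ, trivial, trivial, Subalgebra.algebraMap_mem _ c, one_mem _, one_ne_zero,
          fun q _ _ _ => (div_one _).symm⟩ }
    congr_near := by
      rintro p f g ⟨U, V, a, b, hU, hV, h1, h2, ha, hb, hbp, hab⟩ h
      obtain ⟨U', V', d, hU', hV', hd, h1', h2', hdp, hd'⟩ := (eventually_prod_iff k).1 h
      have l := boxAlg_mono k (U := U) (V := V) (U' := U ∩ U') (V' := V ∩ V')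
        Set.inter_subset_left Set.inter_subset_left
      have r := boxAlg_mono k (U := U') (V := V') (U' := U ∩ U') (V' := V ∩ V')
        Set.inter_subset_right Set.inter_subset_right
      refine ⟨U ∩ U', V ∩ V', a * d, b * d, hU.inter hU', hV.inter hV', ⟨h1, h1'⟩, ⟨h2, h2'⟩,
        mul_mem (l ha) (r hd), mul_mem (l hb) (r hd), mul_ne_zero hbp hdp, ?_⟩
      intro q hq1 hq2 hbd
      have e1 := left_ne_zero_of_mul hbd
      have e2 := right_ne_zero_of_mul hbd
      rw [← hd' q hq1.2 hq2.2 e2, hab q hq1.1 hq2.1 e1]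
      exact (mul_div_mul_right (a q) (b q) e2).symm
    eventually_reg := by
      rintro p f ⟨U, V, a, b, hU, hV, h1, h2, ha, hb, hbp, hab⟩
      exact (eventually_prod_iff k).2 ⟨U, V, b, hU, hV, hb, h1, h2, hbp, fun q q1 q2 q3 =>
        ⟨U, V, a, b, hU, hV, q1, q2, ha, hb, q3, hab⟩⟩
    inv_mem := by
      rintro p f ⟨U, V, a, b, hU, hV, h1, h2, ha, hb, hbp, hab⟩ hp
      have hap : a p ≠ 0 := fun h => hp (by rw [hab p h1 h2 hbp, h, zero_div])
      refine ⟨U, V, b * b, a * b, hU, hV, h1, h2, mul_mem hb hb, mul_mem ha hb,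
        mul_ne_zero hap hbp, fun q q1 q2 q3 => ?_⟩
      have e2 := right_ne_zero_of_mul q3
      change (f q)⁻¹ = b q * b q / (a q * b q)
      rw [hab q q1 q2 e2, inv_div, mul_div_mul_right _ _ e2]
    eventually_ne := by
      rintro p f ⟨U, V, a, b, hU, hV, h1, h2, ha, hb, hbp, hab⟩ hp
      have hap : a p ≠ 0 := fun h => hp (by rw [hab p h1 h2 hbp, h, zero_div])
      refine (eventually_prod_iff k).2 ⟨U, V, a * b, hU, hV, mul_mem ha hb, h1, h2,
        mul_ne_zero hap hbp, fun q q1 q2 q3 => ?_⟩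
      have e1 := left_ne_zero_of_mul q3
      have e2 := right_ne_zero_of_mul q3
      rw [hab q q1 q2 e2]
      exact div_ne_zero e1 e2 }

/-- Morphisms from a product. -/
def IsMorphismProd (φ : X × Y → Z) : Prop :=
  @IsMorphism k _ (VProd X Y) Z (prodTopology k X Y) (prodRegularFunctions k) _ _ φ

/-- The open subset `U`, with the induced structure, is isomorphic to an algebraic subset of affine
space: there are coordinates `t` on `U` identifying `U` with the zero locus of an ideal, and the
topology and the regular functions on `U` are the usual ones in terms of these coordinates. -/
def IsAffineOpen (U : Set X) : Prop :=
  IsOpen U ∧ ∃ (n : ℕ) (t : X → Fin n → k) (I : Ideal (MvPolynomial (Fin n) k)),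
    Set.InjOn t U ∧ t '' U = MvPolynomial.zeroLocus k I ∧
    (∀ x ∈ U, ∀ W : Set X, W ∈ 𝓝 x ↔ ∃ P : MvPolynomial (Fin n) k,
      MvPolynomial.eval (t x) P ≠ 0 ∧ {y | y ∈ U ∧ MvPolynomial.eval (t y) P ≠ 0} ⊆ W) ∧
    ∀ x ∈ U, ∀ f : X → k, f ∈ regAt k x ↔ ∃ P Q : MvPolynomial (Fin n) k,
      MvPolynomial.eval (t x) Q ≠ 0 ∧ ∀ y ∈ U, MvPolynomial.eval (t y) Q ≠ 0 →
        f y = MvPolynomial.eval (t y) P / MvPolynomial.eval (t y) Q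

/-- Algebraic varieties (over an algebraically closed field, not necessarily irreducible):
quasi-compact separated spaces with functions covered by affine open subsets. -/
class IsVariety (k : Type*) [Field k] (X : Type*) [TopologicalSpace X] [RegularFunctions k X] :
    Prop where
  compact : CompactSpace X
  affine : ∀ x : X, ∃ U : Set X, x ∈ U ∧ IsAffineOpen k U
  separated : @IsClosed (VProd X X) (prodTopology k X X) {p | p.1 = p.2}

/-! ### Tangent spaces -/

/-- The tangent space at `x`: derivations at `x` of the functions regular at `x`, extended by zero
to all functions. -/
def TangentSpace (x : X) : Submodule k ((X → k) → k) where
  carrier := {v | (∀ f ∉ regAt k x, v f = 0) ∧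
    (∀ f ∈ regAt k x, ∀ g ∈ regAt k x, v (f + g) = v f + v g) ∧
    (∀ (c : k), ∀ f ∈ regAt k x, v (c • f) = c * v f) ∧
    ∀ f ∈ regAt k x, ∀ g ∈ regAt k x, v (f * g) = f x * v g + g x * v f}
  add_mem' := by
    rintro v w ⟨v0, v1, v2, v3⟩ ⟨w0, w1, w2, w3⟩
    refine ⟨fun f hf => by simp [v0 f hf, w0 f hf], fun f hf g hg => ?_, fun c f hf => ?_,
      fun f hf g hg => ?_⟩
    · simp only [Pi.add_apply, v1 f hf g hg, w1 f hf g hg]; ring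
    · simp only [Pi.add_apply, v2 c f hf, w2 c f hf]; ring
    · simp only [Pi.add_apply, v3 f hf g hg, w3 f hf g hg]; ring
  zero_mem' := by simp
  smul_mem' := by
    rintro c v ⟨v0, v1, v2, v3⟩
    refine ⟨fun f hf => by simp [v0 f hf], fun f hf g hg => ?_, fun c f hf => ?_,
      fun f hf g hg => ?_⟩
    · simp only [Pi.smul_apply, smul_eq_mul, v1 f hf g hg]; ring
    · simp only [Pi.smul_apply, smul_eq_mul, v2 _ f hf]; ring
    · simp only [Pi.smul_apply, smul_eq_mul, v3 f hf g hg]; ring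

variable {k}

theorem tangent_add {x : X} (v : TangentSpace k x) {f g : X → k} (hf : f ∈ regAt k x)
    (hg : g ∈ regAt k x) : v.1 (f + g) = v.1 f + v.1 g := v.2.2.1 f hf g hg

theorem tangent_smul {x : X} (v : TangentSpace k x) (c : k) {f : X → k}
    (hf : f ∈ regAt k x) : v.1 (c • f) = c * v.1 f := v.2.2.2.1 c f hf

theorem tangent_mul {x : X} (v : TangentSpace k x) {f g : X → k} (hf : f ∈ regAt k x)
    (hg : g ∈ regAt k x) : v.1 (f * g) = f x * v.1 g + g x * v.1 f := v.2.2.2.2 f hf g hg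

theorem regAt_congr {x : X} {f g : X → k} (hf : f ∈ regAt k x) (h : f =ᶠ[𝓝 x] g) :
    g ∈ regAt k x := RegularFunctions.congr_near hf h

theorem tangent_congr {x : X} (v : TangentSpace k x) {f g : X → k} (h : f =ᶠ[𝓝 x] g) :
    v.1 f = v.1 g := by
  classical
  by_cases hf : f ∈ regAt k x
  · have hg := regAt_congr hf h
    let e : X → k := fun y => if f y = g y then 0 else 1
    have he0 : (0 : X → k) =ᶠ[𝓝 x] e := by
      filter_upwards [h] with y hy; simp [e, hy]
    have he : e ∈ regAt k x := regAt_congr (zero_mem _) he0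
    have hd : (-1 : k) • g + f ∈ regAt k x := add_mem (Subalgebra.smul_mem _ hg _) hf
    have hz : (-1 : k) • g + f = e * ((-1 : k) • g + f) := by
      ext y
      by_cases hy : f y = g y <;> simp [e, hy]
    have hx := h.self_of_nhds
    have h0 : v.1 ((-1 : k) • g + f) = 0 := by
      rw [hz, tangent_mul v he hd]
      simp [e, hx]
    rw [tangent_add v (Subalgebra.smul_mem _ hg _) hf, tangent_smul v _ hg] at h0
    linear_combination h0
  · have hg : g ∉ regAt k x := fun hg => hf (regAt_congr hg h.symm)
    rw [v.2.1 f hf, v.2.1 g hg]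

/-- Make a tangent vector out of a functional that is only known on regular functions. -/
def tangentMk {x : X} (v : (X → k) → k)
    (h1 : ∀ f ∈ regAt k x, ∀ g ∈ regAt k x, v (f + g) = v f + v g)
    (h2 : ∀ (c : k), ∀ f ∈ regAt k x, v (c • f) = c * v f)
    (h3 : ∀ f ∈ regAt k x, ∀ g ∈ regAt k x, v (f * g) = f x * v g + g x * v f) :
    TangentSpace k x :=
  open Classical in
  ⟨fun f => if f ∈ regAt k x then v f else 0, fun f hf => if_neg hf,
    fun f hf g hg => by
      simp only [if_pos hf, if_pos hg, if_pos (add_mem hf hg), h1 f hf g hg],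
    fun c f hf => by
      simp only [if_pos hf, if_pos (Subalgebra.smul_mem _ hf c), h2 c f hf],
    fun f hf g hg => by
      simp only [if_pos hf, if_pos hg, if_pos (mul_mem hf hg), h3 f hf g hg]⟩

theorem tangent_mk_apply {x : X} {v : (X → k) → k} (h1 h2 h3) {f : X → k}
    (hf : f ∈ regAt k x) : (tangentMk (x := x) v h1 h2 h3).1 f = v f := if_pos hf

theorem tangent_ext {x : X} {v w : TangentSpace k x}
    (h : ∀ f ∈ regAt k x, v.1 f = w.1 f) : v = w := by
  refine Subtype.ext (funext fun f => ?_)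
  by_cases hf : f ∈ regAt k x
  · exact h f hf
  · rw [v.2.1 f hf, w.2.1 f hf]

/-- The differential of a morphism. -/
def tangentMap {φ : X → Y} (hφ : IsMorphism k φ) {x : X} {y : Y} (h : φ x = y) :
    TangentSpace k x →ₗ[k] TangentSpace k y where
  toFun v := tangentMk (fun f => v.1 (f ∘ φ))
    (fun f hf g hg => by
      subst h; exact tangent_add v (hφ.comp_mem _ _ hf) (hφ.comp_mem _ _ hg))
    (fun c f hf => by subst h; exact tangent_smul v c (hφ.comp_mem _ _ hf))
    (fun f hf g hg => by
      subst h; exact tangent_mul v (hφ.comp_mem _ _ hf) (hφ.comp_mem _ _ hg))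
  map_add' v w := tangent_ext fun f hf => by
    rw [tangent_mk_apply _ _ _ hf]
    change _ = (tangentMk _ _ _ _).1 f + (tangentMk _ _ _ _).1 f
    rw [tangent_mk_apply _ _ _ hf, tangent_mk_apply _ _ _ hf]; rfl
  map_smul' c v := tangent_ext fun f hf => by
    rw [tangent_mk_apply _ _ _ hf]
    change _ = c * (tangentMk _ _ _ _).1 f
    rw [tangent_mk_apply _ _ _ hf]; rfl

theorem tangentMap_apply {φ : X → Y} (hφ : IsMorphism k φ) {x : X} {y : Y} (h : φ x = y)
    (v : TangentSpace k x) {f : Y → k} (hf : f ∈ regAt k y) :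
    (tangentMap hφ h v).1 f = v.1 (f ∘ φ) := if_pos hf

/-- The differential at `x` of a function, as a covector. -/
def diffAt (x : X) (f : X → k) : Module.Dual k (TangentSpace k x) where
  toFun v := v.1 f
  map_add' _ _ := rfl
  map_smul' _ _ := rfl


theorem tangent_const {x : X} (v : TangentSpace k x) (c : k) : v.1 (fun _ => c) = 0 := by
  have h1 : (1 : X → k) ∈ regAt k x := one_mem _
  have h2 := tangent_mul v h1 h1
  have h3 := tangent_smul v c h1
  have h4 : (fun _ => c : X → k) = c • (1 : X → k) := by ext; simp
  rw [mul_one, Pi.one_apply, one_mul] at h2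
  rw [h4, h3, show v.1 1 = 0 by linear_combination -h2, mul_zero]

/-! ### Slices of products -/

theorem IsMorphism.comp {ψ : Y → Z} {φ : X → Y} (hψ : IsMorphism k ψ) (hφ : IsMorphism k φ) :
    IsMorphism k (ψ ∘ φ) :=
  ⟨hψ.continuous.comp hφ.continuous, fun x f hf => hφ.comp_mem x _ (hψ.comp_mem _ f hf)⟩

theorem isMorphism_subtype_val (p : X → Prop) : IsMorphism k (Subtype.val : {x // p x} → X) :=
  ⟨continuous_subtype_val, fun _ f hf => ⟨f, hf, Eventually.of_forall fun _ => rfl⟩⟩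

theorem box_slice_right {U : Set X} {V : Set Y} {F : X × Y → k} (hF : F ∈ boxAlg k U V)
    (x : X) {y : Y} (hy : y ∈ V) : (fun y => F (x, y)) ∈ regAt k y := by
  induction hF using Algebra.adjoin_induction with
  | mem F hF =>
    rcases hF with ⟨u, hu, rfl⟩ | ⟨v, hv, rfl⟩
    · exact Subalgebra.algebraMap_mem (regAt k y) (u x)
    · exact hv y hy
  | algebraMap c => exact Subalgebra.algebraMap_mem (regAt k y) c
  | add F G _ _ h1 h2 => exact add_mem h1 h2
  | mul F G _ _ h1 h2 => exact mul_mem h1 h2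

theorem box_slice_left {U : Set X} {V : Set Y} {F : X × Y → k} (hF : F ∈ boxAlg k U V)
    {x : X} (hx : x ∈ U) (y : Y) : (fun x => F (x, y)) ∈ regAt k x := by
  induction hF using Algebra.adjoin_induction with
  | mem F hF =>
    rcases hF with ⟨u, hu, rfl⟩ | ⟨v, hv, rfl⟩
    · exact hu x hx
    · exact Subalgebra.algebraMap_mem (regAt k x) (v y)
  | algebraMap c => exact Subalgebra.algebraMap_mem (regAt k x) c
  | add F G _ _ h1 h2 => exact add_mem h1 h2
  | mul F G _ _ h1 h2 => exact mul_mem h1 h2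

theorem box_deriv {U : Set X} {V : Set Y} {F : X × Y → k} (hF : F ∈ boxAlg k U V)
    {x : X} (hx : x ∈ U) {y : Y} (hy : y ∈ V) (v : TangentSpace k y) :
    (fun x => v.1 fun y => F (x, y)) ∈ regAt k x := by
  induction hF using Algebra.adjoin_induction with
  | mem F hF =>
    rcases hF with ⟨u, hu, rfl⟩ | ⟨w, hw, rfl⟩
    · simp only [tangent_const]
      exact zero_mem _
    · exact Subalgebra.algebraMap_mem (regAt k x) (v.1 fun y => w y)
  | algebraMap c =>
    exact Subalgebra.algebraMap_mem (regAt k x) (v.1 fun _ => c)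
  | add F G hF hG h1 h2 =>
    have : (fun x => v.1 fun y => (F + G) (x, y)) =
        (fun x => v.1 fun y => F (x, y)) + fun x => v.1 fun y => G (x, y) := by
      ext x
      exact tangent_add v (box_slice_right hF x hy) (box_slice_right hG x hy)
    rw [this]
    exact add_mem h1 h2
  | mul F G hF hG h1 h2 =>
    have : (fun x => v.1 fun y => (F * G) (x, y)) =
        (fun x => F (x, y)) * (fun x => v.1 fun y => G (x, y)) +
        (fun x => G (x, y)) * fun x => v.1 fun y => F (x, y) := by
      ext x
      exact tangent_mul v (box_slice_right hF x hy) (box_slice_right hG x hy)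
    rw [this]
    exact add_mem (mul_mem (box_slice_left hF hx y) h2) (mul_mem (box_slice_left hG hx y) h1)

theorem regAt_inv {x : X} {f : X → k} (hf : f ∈ regAt k x) (h : f x ≠ 0) : f⁻¹ ∈ regAt k x :=
  RegularFunctions.inv_mem hf h

theorem prodRegAt_deriv {F : X × Y → k} {x : X} {y : Y} (hF : ProdRegAt k (x, y) F)
    (v : TangentSpace k y) : (fun x => v.1 fun y => F (x, y)) ∈ regAt k x := by
  obtain ⟨U, V, a, b, hU, hV, hx, hy, ha, hb, hb0, hab⟩ := hF
  have hr : (fun x => (v.1 (fun y => a (x, y)) * b (x, y) - a (x, y) * v.1 (fun y => b (x, y)))) *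
      ((fun x => b (x, y)) * (fun x => b (x, y)))⁻¹ ∈ regAt k x :=
    mul_mem (sub_mem (mul_mem (box_deriv ha hx hy v) (box_slice_left hb hx y))
      (mul_mem (box_slice_left ha hx y) (box_deriv hb hx hy v)))
      (regAt_inv (mul_mem (box_slice_left hb hx y) (box_slice_left hb hx y))
        (mul_ne_zero hb0 hb0))
  refine regAt_congr hr ?_
  filter_upwards [hU.mem_nhds hx,
    RegularFunctions.eventually_ne (box_slice_left hb hx y) hb0] with x' hx' hb'
  have hA := box_slice_right ha x' hy
  have hB := box_slice_right hb x' hy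
  have hF' : (fun y => F (x', y)) =ᶠ[𝓝 y] (fun y => a (x', y)) * (fun y => b (x', y))⁻¹ := by
    filter_upwards [hV.mem_nhds hy, RegularFunctions.eventually_ne hB hb'] with y' hy' hb''
    exact (hab (x', y') hx' hy' hb'').trans (div_eq_mul_inv _ _)
  have hFr := regAt_congr (mul_mem hA (regAt_inv hB hb')) hF'.symm
  have hA' : (fun y => a (x', y)) =ᶠ[𝓝 y] (fun y => F (x', y)) * (fun y => b (x', y)) := by
    filter_upwards [hV.mem_nhds hy, RegularFunctions.eventually_ne hB hb'] with y' hy' hb''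
    exact (by rw [hab (x', y') hx' hy' hb'', div_mul_cancel₀ _ hb''] :
      a (x', y') = F (x', y') * b (x', y'))
  have e1 := tangent_congr v hA'
  rw [tangent_mul v hFr hB, hab (x', y) hx' hy hb'] at e1
  change (v.1 (fun y => a (x', y)) * b (x', y) - a (x', y) * v.1 (fun y => b (x', y))) *
    (b (x', y) * b (x', y))⁻¹ = v.1 (fun y => F (x', y))
  rw [e1]
  field_simp
  ring

theorem isMorphism_slice_right {φ : X × Y → Z} (hφ : IsMorphismProd k φ) (x : X) :
    IsMorphism k (fun y => φ (x, y)) := by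
  let _ := prodTopology k X Y
  let _ : RegularFunctions k (VProd X Y) := prodRegularFunctions k
  refine ⟨?_, ?_⟩
  · have hc : @Continuous _ (VProd X Y) _ (prodTopology k X Y) (fun y : Y => ((x, y) : VProd X Y)) := by
      refine continuous_generateFrom_iff.2 ?_
      rintro W ⟨U, V, b, hU, hV, hb, rfl⟩
      refine isOpen_iff_mem_nhds.2 fun y hy => ?_
      obtain ⟨h1, h2, h3⟩ := hy
      filter_upwards [hV.mem_nhds h2,
        RegularFunctions.eventually_ne (box_slice_right hb x h2) h3] with y' h4 h5
      exact ⟨h1, h4, h5⟩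
    exact hφ.continuous.comp hc
  · intro y f hf
    obtain ⟨U, V, a, b, hU, hV, hx, hy, ha, hb, hb0, hab⟩ := hφ.comp_mem (x, y) f hf
    refine regAt_congr (mul_mem (box_slice_right ha x hy)
      (regAt_inv (box_slice_right hb x hy) hb0)) ?_
    filter_upwards [hV.mem_nhds hy,
      RegularFunctions.eventually_ne (box_slice_right hb x hy) hb0] with y' h4 h5
    exact ((hab (x, y') hx h4 h5).trans (div_eq_mul_inv _ _)).symm

theorem isMorphism_slice_left {φ : X × Y → Z} (hφ : IsMorphismProd k φ) (y : Y) :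
    IsMorphism k (fun x => φ (x, y)) := by
  let _ := prodTopology k X Y
  let _ : RegularFunctions k (VProd X Y) := prodRegularFunctions k
  refine ⟨?_, ?_⟩
  · have hc : @Continuous _ (VProd X Y) _ (prodTopology k X Y) (fun x : X => ((x, y) : VProd X Y)) := by
      refine continuous_generateFrom_iff.2 ?_
      rintro W ⟨U, V, b, hU, hV, hb, rfl⟩
      refine isOpen_iff_mem_nhds.2 fun x hx => ?_
      obtain ⟨h1, h2, h3⟩ := hx
      filter_upwards [hU.mem_nhds h1,
        RegularFunctions.eventually_ne (box_slice_left hb h1 y) h3] with x' h4 h5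
      exact ⟨h4, h2, h5⟩
    exact hφ.continuous.comp hc
  · intro x f hf
    obtain ⟨U, V, a, b, hU, hV, hx, hy, ha, hb, hb0, hab⟩ := hφ.comp_mem (x, y) f hf
    refine regAt_congr (mul_mem (box_slice_left ha hx y)
      (regAt_inv (box_slice_left hb hx y) hb0)) ?_
    filter_upwards [hU.mem_nhds hx,
      RegularFunctions.eventually_ne (box_slice_left hb hx y) hb0] with x' h4 h5
    exact ((hab (x', y) h4 hy h5).trans (div_eq_mul_inv _ _)).symm

/-! ### Finite-dimensionality of tangent spaces -/

theorem tangent_polynomial {x : X} (v : TangentSpace k x) {n : ℕ} {t : X → Fin n → k}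
    (ht : ∀ i, (fun y => t y i) ∈ regAt k x) (hv : ∀ i, v.1 (fun y => t y i) = 0)
    (P : MvPolynomial (Fin n) k) :
    (fun y => MvPolynomial.eval (t y) P) ∈ regAt k x ∧
      v.1 (fun y => MvPolynomial.eval (t y) P) = 0 := by
  induction P using MvPolynomial.induction_on with
  | C c =>
    simp only [MvPolynomial.eval_C]
    exact ⟨Subalgebra.algebraMap_mem (regAt k x) c, tangent_const v c⟩
  | add P Q hP hQ =>
    simp only [map_add]
    refine ⟨add_mem hP.1 hQ.1, (tangent_add v hP.1 hQ.1).trans ?_⟩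
    rw [hP.2, hQ.2, add_zero]
  | mul_X P i hP =>
    simp only [map_mul, MvPolynomial.eval_X]
    refine ⟨mul_mem hP.1 (ht i), (tangent_mul v hP.1 (ht i)).trans ?_⟩
    rw [hP.2, hv, mul_zero, mul_zero, add_zero]

instance finiteDimensional_tangentSpace [IsVariety k X] (x : X) :
    FiniteDimensional k (TangentSpace k x) := by
  obtain ⟨U, hxU, hU, n, t, I, hinj, him, htop, hreg⟩ := IsVariety.affine (k := k) x
  have ht : ∀ i, (fun y => t y i) ∈ regAt k x := fun i =>
    (hreg x hxU _).2 ⟨MvPolynomial.X i, 1, by simp, by simp⟩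
  let L : TangentSpace k x →ₗ[k] (Fin n → k) :=
    { toFun := fun v i => v.1 (fun y => t y i)
      map_add' := fun v w => rfl
      map_smul' := fun c v => rfl }
  refine FiniteDimensional.of_injective L ((injective_iff_map_eq_zero L).2 fun v hv => ?_)
  have hv' : ∀ i, v.1 (fun y => t y i) = 0 := fun i => congrFun hv i
  refine tangent_ext fun f hf => ?_
  obtain ⟨P, Q, hQ, hPQ⟩ := (hreg x hxU f).1 hf
  obtain ⟨hP1, hP2⟩ := tangent_polynomial v ht hv' P
  obtain ⟨hQ1, hQ2⟩ := tangent_polynomial v ht hv' Q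
  have e : (fun y => MvPolynomial.eval (t y) P) =ᶠ[𝓝 x]
      f * fun y => MvPolynomial.eval (t y) Q := by
    filter_upwards [hU.mem_nhds hxU, RegularFunctions.eventually_ne hQ1 hQ] with y h1 h2
    exact (by rw [hPQ y h1 h2, div_mul_cancel₀ _ h2] :
      MvPolynomial.eval (t y) P = f y * MvPolynomial.eval (t y) Q)
  have e2 := tangent_congr v e
  rw [hP2, tangent_mul v hf hQ1, hQ2, mul_zero, zero_add] at e2
  exact (mul_eq_zero.1 e2.symm).resolve_left hQ

end Basic

/-! ### Algebraic groups, actions and Lie algebras -/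

/-- Algebraic groups. -/
class IsAlgGroup (k : Type*) [Field k] (D : Type*) [Group D] [TopologicalSpace D]
    [RegularFunctions k D] : Prop extends IsVariety k D where
  mul_morphism : IsMorphismProd k (fun p : D × D => p.1 * p.2)
  inv_morphism : IsMorphism k (fun d : D => d⁻¹)

/-- Algebraic actions. -/
class IsAlgAction (k : Type*) [Field k] (G X : Type*) [Group G] [TopologicalSpace G]
    [RegularFunctions k G] [TopologicalSpace X] [RegularFunctions k X] [MulAction G X] : Prop where
  smul_morphism : IsMorphismProd k (fun p : G × X => p.1 • p.2)

section Groups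

variable (k : Type*) [Field k]

/-- The Lie algebra of an algebraic group, as a vector space. -/
abbrev LieAlg (G : Type*) [Group G] [TopologicalSpace G] [RegularFunctions k G] :=
  TangentSpace k (1 : G)

variable {k}

section Actions

variable {G X : Type*} [Group G] [TopologicalSpace G] [RegularFunctions k G]
  [TopologicalSpace X] [RegularFunctions k X] [MulAction G X] [IsAlgAction k G X]

variable (k G) in
theorem isMorphism_orbit (x : X) : IsMorphism k (fun g : G => g • x) :=
  isMorphism_slice_left (IsAlgAction.smul_morphism (k := k) (G := G) (X := X)) x

/-- The infinitesimal action `v ↦ a(v)`, as a vector at `x`.  The sign makes `a` a morphism of Lie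
algebras: `a(v).f` is the derivative of `f (exp (-t v) • x)` at `t = 0`. -/
def infAction (x : X) : LieAlg k G →ₗ[k] TangentSpace k x :=
  -tangentMap (isMorphism_orbit k G x) (one_smul G x)

end Actions

section LieBracket

variable {D : Type*} [Group D] [TopologicalSpace D] [RegularFunctions k D] [IsAlgGroup k D]

/-- The derivative of `F` along the left-invariant vector field with value `v` at the unit. -/
def leftDeriv (v : LieAlg k D) (F : D → k) (d : D) : k := v.1 fun x => F (d * x)

theorem regAt_mul_left {F : D → k} {d : D} (hF : F ∈ regAt k d) :
    (fun x => F (d * x)) ∈ regAt k (1 : D) :=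
  (isMorphism_slice_right (IsAlgGroup.mul_morphism (k := k) (D := D)) d).comp_mem 1 F
    (by simpa using hF)

theorem leftDeriv_mem (v : LieAlg k D) {F : D → k} (hF : F ∈ regAt k (1 : D)) :
    leftDeriv v F ∈ regAt k (1 : D) := by
  let _ := prodTopology k D D
  let _ : RegularFunctions k (VProd D D) := prodRegularFunctions k
  have h : ProdRegAt k ((1, 1) : D × D) (F ∘ fun p : D × D => p.1 * p.2) :=
    (IsAlgGroup.mul_morphism (k := k) (D := D)).comp_mem (1, 1) F (by simpa using hF)
  exact prodRegAt_deriv h v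

theorem leftDeriv_add (v : LieAlg k D) {F G : D → k} (hF : F ∈ regAt k (1 : D))
    (hG : G ∈ regAt k (1 : D)) :
    leftDeriv v (F + G) =ᶠ[𝓝 1] leftDeriv v F + leftDeriv v G := by
  filter_upwards [RegularFunctions.eventually_reg hF, RegularFunctions.eventually_reg hG] with d h1 h2
  exact tangent_add v (regAt_mul_left h1) (regAt_mul_left h2)

theorem leftDeriv_smul (v : LieAlg k D) (c : k) {F : D → k} (hF : F ∈ regAt k (1 : D)) :
    leftDeriv v (c • F) =ᶠ[𝓝 1] c • leftDeriv v F := by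
  filter_upwards [RegularFunctions.eventually_reg hF] with d h1
  exact tangent_smul v c (regAt_mul_left h1)

theorem leftDeriv_mul (v : LieAlg k D) {F G : D → k} (hF : F ∈ regAt k (1 : D))
    (hG : G ∈ regAt k (1 : D)) :
    leftDeriv v (F * G) =ᶠ[𝓝 1] F * leftDeriv v G + G * leftDeriv v F := by
  filter_upwards [RegularFunctions.eventually_reg hF, RegularFunctions.eventually_reg hG] with d h1 h2
  refine (tangent_mul v (regAt_mul_left h1) (regAt_mul_left h2)).trans ?_
  simp [leftDeriv]

theorem leftDeriv_one (v : LieAlg k D) (F : D → k) : leftDeriv v F 1 = v.1 F := by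
  simp [leftDeriv]

/-- The Lie bracket: the commutator of left-invariant vector fields. -/
def lieBracket (u v : LieAlg k D) : LieAlg k D :=
  tangentMk (fun f => u.1 (leftDeriv v f) - v.1 (leftDeriv u f))
    (fun f hf g hg => by
      rw [tangent_congr u (leftDeriv_add v hf hg), tangent_congr v (leftDeriv_add u hf hg),
        tangent_add u (leftDeriv_mem v hf) (leftDeriv_mem v hg),
        tangent_add v (leftDeriv_mem u hf) (leftDeriv_mem u hg)]
      ring)
    (fun c f hf => by
      rw [tangent_congr u (leftDeriv_smul v c hf), tangent_congr v (leftDeriv_smul u c hf),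
        tangent_smul u c (leftDeriv_mem v hf), tangent_smul v c (leftDeriv_mem u hf)]
      ring)
    (fun f hf g hg => by
      rw [tangent_congr u (leftDeriv_mul v hf hg), tangent_congr v (leftDeriv_mul u hf hg),
        tangent_add u (mul_mem hf (leftDeriv_mem v hg)) (mul_mem hg (leftDeriv_mem v hf)),
        tangent_add v (mul_mem hf (leftDeriv_mem u hg)) (mul_mem hg (leftDeriv_mem u hf)),
        tangent_mul u hf (leftDeriv_mem v hg), tangent_mul u hg (leftDeriv_mem v hf),
        tangent_mul v hf (leftDeriv_mem u hg), tangent_mul v hg (leftDeriv_mem u hf)]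
      simp only [leftDeriv_one]
      ring)

variable (k) in
theorem isMorphism_conj (d : D) : IsMorphism k (fun x : D => d * x * d⁻¹) :=
  (isMorphism_slice_left (IsAlgGroup.mul_morphism (k := k) (D := D)) d⁻¹).comp
    (isMorphism_slice_right (IsAlgGroup.mul_morphism (k := k) (D := D)) d)

/-- The adjoint action. -/
def Ad (d : D) : LieAlg k D →ₗ[k] LieAlg k D :=
  tangentMap (isMorphism_conj k d) (by simp)

/-- The inclusion of the Lie algebra of a subgroup. -/
def lieIncl (G : Subgroup D) : LieAlg k G →ₗ[k] LieAlg k D :=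
  tangentMap (isMorphism_subtype_val (k := k) (fun d : D => d ∈ G)) rfl

theorem lieIncl_injective (G : Subgroup D) :
    Function.Injective (lieIncl (k := k) G) := by
  refine (injective_iff_map_eq_zero _).2 fun v hv => tangent_ext fun f hf => ?_
  obtain ⟨F, hF, hfF⟩ := hf
  have h1 : (lieIncl G v).1 F = 0 := by rw [hv]; rfl
  rw [tangent_congr v hfF]
  rw [lieIncl, tangentMap_apply _ _ _ hF] at h1
  exact h1

end LieBracket

/-! ### Group pairs and Lagrangian complements -/

/-- A group pair `(D, G)`: a closed subgroup `G` of `D` and a nondegenerate `D`-invariant symmetric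
pairing on the Lie algebra of `D` for which the Lie algebra of `G` is Lagrangian. -/
structure GroupPair (k : Type*) [Field k] (D : Type*) [Group D] [TopologicalSpace D]
    [RegularFunctions k D] [IsAlgGroup k D] where
  G : Subgroup D
  isClosed : IsClosed (G : Set D)
  form : LinearMap.BilinForm k (LieAlg k D)
  symm : form.IsSymm
  nondegenerate : form.Nondegenerate
  invariant : ∀ (d : D) (v w : LieAlg k D), form (Ad d v) (Ad d w) = form v w
  lagrangian : form.orthogonal (LinearMap.range (lieIncl (k := k) G)) =
    LinearMap.range (lieIncl (k := k) G)

variable {D : Type*} [Group D] [TopologicalSpace D] [RegularFunctions k D] [IsAlgGroup k D]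

/-- A Lagrangian complement to the Lie algebra of `G`; it need not be a Lie subalgebra. -/
structure LagrangianComplement (P : GroupPair k D) where
  space : Submodule k (LieAlg k D)
  lagrangian : P.form.orthogonal space = space
  isCompl : IsCompl (LinearMap.range (lieIncl (k := k) P.G)) space

namespace GroupPair

variable (P : GroupPair k D)

/-- The identification of the dual of the Lie algebra of `D` with itself given by the pairing. -/
def dualIso : Module.Dual k (LieAlg k D) ≃ₗ[k] LieAlg k D :=
  (P.form.toDual P.nondegenerate).symm

/-- The projection to the Lie algebra of `G` along the complement, on vectors. -/
def proj (h : LagrangianComplement P) : LieAlg k D →ₗ[k] LieAlg k P.G :=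
  LinearMap.linearProjOfIsCompl h.space (lieIncl P.G) (lieIncl_injective P.G) h.isCompl

/-- The projection `p_h` from the dual of the Lie algebra of `D` to the Lie algebra of `G`. -/
def p (h : LagrangianComplement P) : Module.Dual k (LieAlg k D) →ₗ[k] LieAlg k P.G :=
  P.proj h ∘ₗ P.dualIso.toLinearMap

/-- The map `j` from the dual of the Lie algebra of `G` to the complement `h` given by the pairing:
`j α` is the element of `h` which pairs with `x` to `α x`. -/
def j (h : LagrangianComplement P) : Module.Dual k (LieAlg k P.G) →ₗ[k] LieAlg k D :=
  P.dualIso.toLinearMap ∘ₗ (P.proj h).dualMap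

/-- The canonical `r`-matrix, i.e. the canonical element `∑ xⁱ ⊗ xᵢ` of `h ⊗ 𝔤` (with `xᵢ` a basis of
`𝔤` and `xⁱ` the dual basis of `h`), as a bilinear form on the dual of the Lie algebra of `D`. -/
def rMatrix (h : LagrangianComplement P) (α β : Module.Dual k (LieAlg k D)) : k :=
  β (lieIncl P.G (P.p h α))

/-- The bracket of functions on `D` defined by the bivector `r^R - r^L`, where `r^R` and `r^L` are the
right-invariant and the left-invariant tensors with value `r` at the unit. This is the quasi-Poisson
bivector of `D`, and its restriction to `G` is the quasi-Poisson bivector of `G`. -/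
def bracketD (h : LagrangianComplement P) (F₁ F₂ : D → k) (d : D) : k :=
  P.rMatrix h (diffAt 1 fun x => F₁ (x * d)) (diffAt 1 fun x => F₂ (x * d)) -
    P.rMatrix h (diffAt 1 fun x => F₁ (d * x)) (diffAt 1 fun x => F₂ (d * x))

/-- The trivector `φ` of the quasi-Poisson group `G`, as a trilinear form on the dual of `𝔤`. -/
def trivector (h : LagrangianComplement P) (α β γ : Module.Dual k (LieAlg k P.G)) : k :=
  P.form (lieBracket (P.j h α) (P.j h β)) (P.j h γ)

/-- The complement `h₂` differs from `h₁` by the twist `t ∈ ∧² 𝔤`, regarded as an alternating form on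
the dual of `𝔤`: the difference of the two projections is `ξ ↦ -t (ξ|_𝔤, ·)`. -/
def IsTwist (h₁ h₂ : LagrangianComplement P)
    (t : LinearMap.BilinForm k (Module.Dual k (LieAlg k P.G))) : Prop :=
  t.IsAlt ∧ ∀ (ξ : Module.Dual k (LieAlg k D)) (β : Module.Dual k (LieAlg k P.G)),
    β (P.p h₂ ξ) - β (P.p h₁ ξ) = -t ((lieIncl P.G).dualMap ξ) β

end GroupPair

/-! ### Bivectors and quasi-Poisson varieties -/

/-- A bivector field: a skew-symmetric biderivation of the structure sheaf. Only the values of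
`br f g` at points where `f` and `g` are regular are meaningful. -/
structure Bivector (k : Type*) [Field k] (X : Type*) [TopologicalSpace X]
    [RegularFunctions k X] where
  br : (X → k) → (X → k) → X → k
  regular : ∀ x, ∀ f ∈ regAt k x, ∀ g ∈ regAt k x, br f g ∈ regAt k x
  skew : ∀ x, ∀ f ∈ regAt k x, ∀ g ∈ regAt k x, br f g x = -br g f x
  add : ∀ x, ∀ f ∈ regAt k x, ∀ g ∈ regAt k x, ∀ h ∈ regAt k x,
    br (f + g) h x = br f h x + br g h x
  smul : ∀ x, ∀ c : k, ∀ f ∈ regAt k x, ∀ h ∈ regAt k x, br (c • f) h x = c * br f h x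
  leibniz : ∀ x, ∀ f ∈ regAt k x, ∀ g ∈ regAt k x, ∀ h ∈ regAt k x,
    br (f * g) h x = f x * br g h x + g x * br f h x

namespace Bivector

variable {X : Type*} [TopologicalSpace X] [RegularFunctions k X] (π : Bivector k X)

/-- The tangent vector `{·, f}` at `x`. -/
def ham (x : X) (f : X → k) (hf : f ∈ regAt k x) : TangentSpace k x :=
  tangentMk (fun g => π.br g f x) (fun g hg g' hg' => π.add x g hg g' hg' f hf)
    (fun c g hg => π.smul x c g hg f hf) (fun g hg g' hg' => π.leibniz x g hg g' hg' f hf)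

theorem ham_add (x : X) {f g : X → k} (hf : f ∈ regAt k x) (hg : g ∈ regAt k x) :
    π.ham x (f + g) (add_mem hf hg) = π.ham x f hf + π.ham x g hg := by
  refine tangent_ext fun u hu => ?_
  change (π.ham x (f + g) _).1 u = (π.ham x f hf).1 u + (π.ham x g hg).1 u
  simp only [ham, tangentMk, if_pos hu]
  rw [π.skew x u hu _ (add_mem hf hg), π.add x f hf g hg u hu, π.skew x u hu f hf,
    π.skew x u hu g hg]
  ring

theorem ham_smul (x : X) (c : k) {f : X → k} (hf : f ∈ regAt k x) :
    π.ham x (c • f) (Subalgebra.smul_mem _ hf c) = c • π.ham x f hf := by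
  refine tangent_ext fun u hu => ?_
  change (π.ham x (c • f) _).1 u = c * (π.ham x f hf).1 u
  simp only [ham, tangentMk, if_pos hu]
  rw [π.skew x u hu _ (Subalgebra.smul_mem _ hf c), π.smul x c f hf u hu, π.skew x u hu f hf]
  ring

theorem ham_mul (x : X) {f g : X → k} (hf : f ∈ regAt k x) (hg : g ∈ regAt k x) :
    π.ham x (f * g) (mul_mem hf hg) = f x • π.ham x g hg + g x • π.ham x f hf := by
  refine tangent_ext fun u hu => ?_
  change (π.ham x (f * g) _).1 u = f x * (π.ham x g hg).1 u + g x * (π.ham x f hf).1 u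
  simp only [ham, tangentMk, if_pos hu]
  rw [π.skew x u hu _ (mul_mem hf hg), π.leibniz x f hf g hg u hu, π.skew x u hu f hf,
    π.skew x u hu g hg]
  ring

/-- The map `π^♯` from covectors to vectors, characterized by `π^♯(dg).f = {g, f}`. -/
def sharp (x : X) : Module.Dual k (TangentSpace k x) →ₗ[k] TangentSpace k x :=
  open Classical in
  { toFun := fun β => tangentMk (fun f => if hf : f ∈ regAt k x then β (π.ham x f hf) else 0)
      (fun f hf g hg => by
        simp only [dif_pos hf, dif_pos hg, dif_pos (add_mem hf hg), ham_add π x hf hg, map_add])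
      (fun c f hf => by
        simp only [dif_pos hf, dif_pos (Subalgebra.smul_mem _ hf c), ham_smul π x c hf, map_smul,
          smul_eq_mul])
      (fun f hf g hg => by
        simp only [dif_pos hf, dif_pos hg, dif_pos (mul_mem hf hg), ham_mul π x hf hg, map_add,
          map_smul, smul_eq_mul])
    map_add' := fun β γ => tangent_ext fun f hf => by
      change (tangentMk _ _ _ _).1 f = (tangentMk _ _ _ _).1 f + (tangentMk _ _ _ _).1 f
      simp only [tangentMk, if_pos hf, dif_pos hf, LinearMap.add_apply]
    map_smul' := fun c β => tangent_ext fun f hf => by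
      change (tangentMk _ _ _ _).1 f = c * (tangentMk _ _ _ _).1 f
      simp only [tangentMk, if_pos hf, dif_pos hf, LinearMap.smul_apply, smul_eq_mul] }

theorem sharp_diffAt (x : X) {f g : X → k} (hf : f ∈ regAt k x) (hg : g ∈ regAt k x) :
    (π.sharp x (diffAt x g)).1 f = π.br g f x := by
  simp only [sharp, LinearMap.coe_mk, AddHom.coe_mk, tangentMk, if_pos hf, dif_pos hf]
  exact if_pos hg

end Bivector

section QuasiPoissonVariety

variable (P : GroupPair k D) {X : Type*} [TopologicalSpace X] [RegularFunctions k X]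
  [MulAction P.G X] [IsAlgAction k P.G X]

/-- The covector `x ↦ a(x).f` on the Lie algebra of `G`, at a point of `X`. -/
def infCovector (x : X) (f : X → k) : Module.Dual k (LieAlg k P.G) :=
  (infAction (k := k) (G := P.G) x).dualMap (diffAt x f)

/-- `(X, π)` is a quasi-Poisson variety for the quasi-Poisson group structure on `G` defined by the
complement `h`. -/
structure IsQuasiPoisson (h : LagrangianComplement P) (π : Bivector k X) : Prop where
  /-- The action map is compatible with the bivectors. The bivector of `G` is computed on functions
  `F₁`, `F₂` on `D` which extend the functions `g' ↦ fᵢ (g' • x)` on `G` near `g`. -/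
  action_compat : ∀ (g : P.G) (x : X), ∀ f₁ ∈ regAt k (g • x), ∀ f₂ ∈ regAt k (g • x),
    ∀ F₁ ∈ regAt k (g : D), ∀ F₂ ∈ regAt k (g : D),
    (∀ᶠ g' : P.G in 𝓝 g, F₁ (g' : D) = f₁ (g' • x)) →
    (∀ᶠ g' : P.G in 𝓝 g, F₂ (g' : D) = f₂ (g' • x)) →
    π.br f₁ f₂ (g • x) =
      π.br (fun y => f₁ (g • y)) (fun y => f₂ (g • y)) x + P.bracketD h F₁ F₂ g
  /-- `½ [π, π] = a(φ)`, where the left-hand side is the Jacobiator of the bracket. -/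
  jacobiator : ∀ x : X, ∀ f₁ ∈ regAt k x, ∀ f₂ ∈ regAt k x, ∀ f₃ ∈ regAt k x,
    π.br f₁ (π.br f₂ f₃) x + π.br f₂ (π.br f₃ f₁) x + π.br f₃ (π.br f₁ f₂) x =
      P.trivector h (infCovector P x f₁) (infCovector P x f₂) (infCovector P x f₃)

variable (X) in
/-- A quasi-Poisson structure on the `G`-variety `X` for the group pair `(D, G)`: a family of bivectors
indexed by the Lagrangian complements, related by twists. -/
structure QuasiPoissonStructure where
  π : LagrangianComplement P → Bivector k X
  isQuasiPoisson : ∀ h, IsQuasiPoisson P h (π h)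
  twist : ∀ (h₁ h₂ : LagrangianComplement P)
    (t : LinearMap.BilinForm k (Module.Dual k (LieAlg k P.G))), P.IsTwist h₁ h₂ t →
    ∀ x : X, ∀ f₁ ∈ regAt k x, ∀ f₂ ∈ regAt k x,
      (π h₂).br f₁ f₂ x = (π h₁).br f₁ f₂ x - t (infCovector P x f₁) (infCovector P x f₂)

end QuasiPoissonVariety

/-! ### The quotient `D/G` and moment maps -/

/-- The homogeneous `D`-variety `Q` with base point `o` is the quotient `D/G`: the orbit map `d ↦ d • o`
is surjective and smooth (a submersion; by homogeneity it is enough to look at the unit) and the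
scheme-theoretic stabilizer of `o` is `G`, i.e. the stabilizer on points is `G` and the infinitesimal
stabilizer is the Lie algebra of `G`. -/
structure IsQuotient (G : Subgroup D) {Q : Type*} [TopologicalSpace Q] [RegularFunctions k Q]
    [MulAction D Q] [IsAlgAction k D Q] (o : Q) : Prop where
  transitive : ∀ q : Q, ∃ d : D, d • o = q
  stabilizer : MulAction.stabilizer D o = G
  lie_stabilizer : LinearMap.ker (infAction (k := k) (G := D) o) = LinearMap.range (lieIncl G)
  smooth : Function.Surjective (infAction (k := k) (G := D) o)

section MomentMaps

variable {P : GroupPair k D}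
  {Q : Type*} [TopologicalSpace Q] [RegularFunctions k Q] [MulAction D Q] [IsAlgAction k D Q]
  {X : Type*} [TopologicalSpace X] [RegularFunctions k X] [MulAction P.G X] [IsAlgAction k P.G X]

/-- The moment map condition for some Lagrangian complement. -/
def IsMomentMap (S : QuasiPoissonStructure P X) (μ : X → Q) : Prop :=
  ∃ h : LagrangianComplement P, ∀ (n : ℕ) (e : Module.Basis (Fin n) k (LieAlg k D)) (x : X),
    ∀ f₁ ∈ regAt k (μ x), ∀ f₂ ∈ regAt k x,
      (S.π h).br (f₁ ∘ μ) f₂ x =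
        ∑ i, (infAction (μ x) (e i)).1 f₁ * (infAction x (P.p h (e.dualBasis i))).1 f₂

/-- The infinitesimal action restricted to the complement. -/
def complAction (h : LagrangianComplement P) (s : Q) : h.space →ₗ[k] TangentSpace k s :=
  infAction s ∘ₗ h.space.subtype

/-- The complement `h` is admissible at `s ∈ D/G`. -/
def IsAdmissible (h : LagrangianComplement P) (s : Q) : Prop :=
  Function.Bijective (complAction h s)

/-- The covector `⟨θ^h, ξ⟩` at `s`: its value on the vector `ã(y)`, `y ∈ h`, is the pairing of `ξ`
and `y`. -/
def theta (h : LagrangianComplement P) {s : Q} (hs : IsAdmissible h s) (ξ : LieAlg k P.G) :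
    Module.Dual k (TangentSpace k s) :=
  P.form (lieIncl P.G ξ) ∘ₗ h.space.subtype ∘ₗ
    (LinearEquiv.ofBijective (complAction h s) hs).symm.toLinearMap

/-- The Alekseev--Kosmann-Schwarzbach moment map condition. -/
def IsAKSMomentMap (S : QuasiPoissonStructure P X) {μ : X → Q} (hμ : IsMorphism k μ) : Prop :=
  ∀ (U : Set Q), IsOpen U → ∀ (h : LagrangianComplement P) (hU : ∀ s ∈ U, IsAdmissible h s)
    (x : X) (hx : μ x ∈ U) (ξ : LieAlg k P.G),
    infAction x ξ = (S.π h).sharp x ((tangentMap hμ rfl).dualMap (theta h (hU _ hx) ξ))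

end MomentMaps

end Groups

end QuasiPoisson

end

open QuasiPoisson

/-!
Fix a point `x` and a function `f₁` near `μ x`, and let `η` be the covector `v ↦ ã(v).f₁` on `𝔡`.
Free of coordinates, the first condition at `x` reads `{μ^* f₁, f₂}_h = a(p_h η).f₂`
(`IsMomentMapAt`).

Any two Lagrangian complements differ by a twist (`GroupPair.exists_isTwist`), and by equivariance
of `μ` the twist changes both sides of this equation by the same amount; so at each point the
condition does not depend on `h` (`IsMomentMapAt.of_complement`).

If `h` is admissible at `μ x`, then `df₁ = ⟨θ^h, ξ⟩` holds precisely for `ξ = p_h η`, because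
both conditions say that `η` and `c(ξ, ·)` agree on `h`.  Every covector is the differential of a
regular function, so at `x` the condition for `h` is the condition of Alekseev and
Kosmann-Schwarzbach (`isMomentMapAt_iff`).

It remains to see that every `s ∈ D/G` has a Lagrangian complement that is admissible on a
neighbourhood of `s` (`IsQuotient.isOpen_setOf_isCompl`, `IsQuotient.exists_isAdmissible`).
Admissibility at `s` means transversality to the infinitesimal stabilizer `𝔤_s`, which is Lagrangian, and it is
an open condition.  Two Lagrangian subspaces need not have a common Lagrangian complement, and
here irreducibility enters: pick Lagrangian complements `H` of `𝔤` and `K` of `𝔤_s`; the nonempty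
open sets where `H` and `K` are transversal to the stabilizer meet in a point `s'`.  The Lagrangian
complements of `𝔤_{s'}` form an affine space, and on its line through `H` and `K` all but finitely
many points are complements of both `𝔤` and `𝔤_s` (`exists_common_lagrangian_complement`).
-/

namespace QuasiPoisson

/-! ### Lagrangian complements in a quadratic space -/

section Lagrangian

variable {k V : Type*} [Field k] [AddCommGroup V] [Module k V]

/-- An isotropic complement of a Lagrangian subspace is Lagrangian. -/
theorem orthogonal_eq_of_isCompl {B : LinearMap.BilinForm k V} (hn : B.Nondegenerate)
    {L H : Submodule k V} (hL : B.orthogonal L = L) (hc : IsCompl L H)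
    (hH : ∀ v ∈ H, ∀ w ∈ H, B v w = 0) : B.orthogonal H = H := by
  refine le_antisymm (fun w hw => ?_) fun w hw v hv => hH v hv w hw
  obtain ⟨l, hl, h, hh, rfl⟩ := Submodule.mem_sup.1 (hc.sup_eq_top ▸ Submodule.mem_top : w ∈ L ⊔ H)
  have hl0 : l = 0 := by
    refine hn.2 l fun v => ?_
    obtain ⟨l', hl', h', hh', rfl⟩ :=
      Submodule.mem_sup.1 (hc.sup_eq_top ▸ Submodule.mem_top : v ∈ L ⊔ H)
    have e1 : B l' l = 0 := (hL.symm ▸ hl : l ∈ B.orthogonal L) l' hl'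
    have e2 : B h' (l + h) = 0 := hw h' hh'
    rw [map_add, hH h' hh' h hh, add_zero] at e2
    rw [map_add, LinearMap.add_apply, e1, e2, add_zero]
  rwa [hl0, zero_add]

/-- If twice the bilinear form is recovered on the diagonal by a projection `q` onto the Lagrangian
subspace `L`, then the kernel of `q` is a Lagrangian complement of `L`.  Since the condition on `q`
is affine, the Lagrangian complements of `L` form an affine space. -/
theorem orthogonal_ker_eq {B : LinearMap.BilinForm k V} (h2 : (2 : k) ≠ 0) (hs : B.IsSymm)
    (hn : B.Nondegenerate) {L : Submodule k V} (hL : B.orthogonal L = L) {q : V →ₗ[k] L}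
    (hq : ∀ x : L, q x = x) (hB : ∀ v, B v v = 2 * B v (q v)) :
    B.orthogonal (LinearMap.ker q) = LinearMap.ker q := by
  have hd : ∀ v ∈ LinearMap.ker q, B v v = 0 := fun v hv => by
    rw [hB, LinearMap.mem_ker.1 hv]; simp
  refine orthogonal_eq_of_isCompl hn hL (LinearMap.isCompl_of_proj hq) fun v hv w hw => ?_
  have h := hd (v + w) (add_mem hv hw)
  simp only [map_add, LinearMap.add_apply, hd v hv, hd w hw, hs.eq w v] at h
  refine (mul_eq_zero.1 (?_ : 2 * B v w = 0)).resolve_left h2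
  linear_combination h

/-- The projection onto a Lagrangian subspace along a Lagrangian complement satisfies the condition of
`orthogonal_ker_eq`. -/
theorem exists_projection_of_isCompl {B : LinearMap.BilinForm k V} (hs : B.IsSymm)
    {L H : Submodule k V} (hL : B.orthogonal L = L) (hH : B.orthogonal H = H) (hc : IsCompl L H) :
    ∃ q : V →ₗ[k] L, LinearMap.ker q = H ∧ (∀ x : L, q x = x) ∧ ∀ v, B v v = 2 * B v (q v) := by
  refine ⟨L.projectionOnto H hc, by simp, fun x => by simp, fun v => ?_⟩
  set q := L.projectionOnto H hc
  have hk : v - q v ∈ H := by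
    rw [← Submodule.ker_projectionOnto hc, LinearMap.mem_ker, map_sub,
      Submodule.projectionOnto_apply_left, sub_self]
  have e1 : B (v - q v) (v - q v) = 0 := (hH.symm ▸ hk : _ ∈ B.orthogonal H) _ hk
  have e2 : B (q v) (q v) = 0 :=
    (hL.symm ▸ (q v).2 : (q v : V) ∈ B.orthogonal L) _ (q v).2
  simp only [map_sub, LinearMap.sub_apply, e2, hs.eq (q v : V) v] at e1
  linear_combination e1

/-- Lagrangian complements exist: if `p` is any projection onto `L` and `p*` is its adjoint, then
`(p + 1 - p*) / 2` is a projection onto `L` with Lagrangian kernel. -/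
theorem exists_lagrangian_complement [FiniteDimensional k V] {B : LinearMap.BilinForm k V}
    (h2 : (2 : k) ≠ 0) (hs : B.IsSymm) (hn : B.Nondegenerate) {L : Submodule k V}
    (hL : B.orthogonal L = L) : ∃ H : Submodule k V, B.orthogonal H = H ∧ IsCompl L H := by
  obtain ⟨W, hW⟩ := L.exists_isCompl
  let p : V →ₗ[k] V := L.subtype ∘ₗ L.projectionOnto W hW
  have hpm : ∀ v, p v ∈ L := fun v => (L.projectionOnto W hW v).2
  have hp : ∀ x ∈ L, p x = x := fun x hx => by
    simpa [p] using congrArg Subtype.val (Submodule.projectionOnto_apply_left hW ⟨x, hx⟩)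
  let a : V →ₗ[k] V := (B.toDual hn).symm.toLinearMap ∘ₗ p.dualMap ∘ₗ (B.toDual hn).toLinearMap
  have ha : ∀ v w, B (a v) w = B v (p w) := fun v w => by
    simp [a, LinearMap.BilinForm.apply_toDual_symm_apply, LinearMap.BilinForm.toDual_def]
  have hmem : ∀ v, ((2 : k)⁻¹ • (p + LinearMap.id - a) : V →ₗ[k] V) v ∈ L := fun v => by
    have h : v - a v ∈ B.orthogonal L := fun l hl => by
      rw [hs.eq, map_sub, LinearMap.sub_apply, ha, hp l hl, sub_self]
    rw [hL] at h
    have := L.smul_mem (2 : k)⁻¹ (add_mem (hpm v) h)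
    simpa [add_sub_assoc] using this
  let q : V →ₗ[k] L := LinearMap.codRestrict L _ hmem
  have hqv : ∀ v, (q v : V) = (2 : k)⁻¹ • (p v + v - a v) := fun v => rfl
  have hq : ∀ x : L, q x = x := fun x => by
    have h0 : a x = 0 := hn.1 _ fun w => by
      rw [ha]
      exact (hL.symm ▸ hpm w : p w ∈ B.orthogonal L) x x.2
    refine Subtype.ext ?_
    rw [hqv, h0, hp x x.2, sub_zero, ← two_smul k (x : V), smul_smul, inv_mul_cancel₀ h2, one_smul]
  refine ⟨LinearMap.ker q, orthogonal_ker_eq h2 hs hn hL hq fun v => ?_,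
    LinearMap.isCompl_of_proj hq⟩
  rw [hqv, map_smul, smul_eq_mul, mul_inv_cancel_left₀ h2, map_sub, map_add, hs.eq v (a v), ha]
  ring

/-- On a line through a bijective linear map, all but finitely many maps are injective: `f + c • g` kills
a nonzero vector only if `-c⁻¹` is an eigenvalue of `f⁻¹ ∘ g`. -/
theorem finite_not_injective_add_smul {W : Type*} [AddCommGroup W] [Module k W]
    [FiniteDimensional k V] {f : V →ₗ[k] W} (hf : Function.Bijective f) (g : V →ₗ[k] W) :
    {c : k | ¬ Function.Injective (f + c • g)}.Finite := by
  let e := LinearEquiv.ofBijective f hf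
  let T : Module.End k V := e.symm.toLinearMap ∘ₗ g
  have hinj : Function.Injective fun c : k => -c⁻¹ := fun a b h => inv_injective (neg_injective h)
  refine (T.finite_hasEigenvalue.preimage hinj.injOn).subset fun c hc => ?_
  have hc' : ¬ ∀ v, (f + c • g) v = 0 → v = 0 := fun h => hc ((injective_iff_map_eq_zero _).2 h)
  push Not at hc'
  obtain ⟨v, hv, hv0⟩ := hc'
  have h1 : v + c • T v = 0 := by
    apply e.injective
    simpa [T, e] using hv
  have hc0 : c ≠ 0 := by
    rintro rfl
    exact hv0 (by simpa using h1)
  refine Module.End.hasEigenvalue_of_hasEigenvector (x := v)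
    ⟨Module.End.mem_eigenspace_iff.2 ?_, hv0⟩
  rw [neg_smul, ← smul_neg, ← eq_neg_of_add_eq_zero_right h1, smul_smul, inv_mul_cancel₀ hc0,
    one_smul]

/-- If `L₁, L₂` have a common Lagrangian complement and `L₂, L₃` have one, then so do `L₁, L₃`: on the
line joining the two in the affine space of Lagrangian complements of `L₂`, all but finitely many
points are complements of `L₁` and of `L₃`. -/
theorem exists_common_lagrangian_complement [FiniteDimensional k V] [Infinite k]
    {B : LinearMap.BilinForm k V} (h2 : (2 : k) ≠ 0) (hs : B.IsSymm) (hn : B.Nondegenerate)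
    {L₁ L₂ L₃ H K : Submodule k V} (hL₂ : B.orthogonal L₂ = L₂)
    (hH : B.orthogonal H = H) (hK : B.orthogonal K = K) (hH₁ : IsCompl L₁ H) (hH₂ : IsCompl L₂ H)
    (hK₂ : IsCompl L₂ K) (hK₃ : IsCompl L₃ K) :
    ∃ M : Submodule k V, B.orthogonal M = M ∧ IsCompl L₁ M ∧ IsCompl L₃ M := by
  obtain ⟨q, hqk, hq, hqB⟩ := exists_projection_of_isCompl hs hL₂ hH hH₂
  obtain ⟨r, hrk, hr, hrB⟩ := exists_projection_of_isCompl hs hL₂ hK hK₂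
  have hbij : ∀ {L N : Submodule k V} {p : V →ₗ[k] L₂}, LinearMap.ker p = N →
      (∀ x : L₂, p x = x) → IsCompl L N → Function.Bijective (p ∘ₗ L.subtype) := by
    rintro L N p rfl hp hc
    refine ⟨(injective_iff_map_eq_zero _).2 fun v hv => ?_, fun w => ?_⟩
    · have : (v : V) ∈ L ⊓ LinearMap.ker p := ⟨v.2, hv⟩
      rw [hc.inf_eq_bot] at this
      exact Subtype.ext this
    · obtain ⟨l, hl, n, hn, e⟩ := Submodule.mem_sup.1
        (hc.sup_eq_top ▸ Submodule.mem_top : (w : V) ∈ L ⊔ LinearMap.ker p)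
      refine ⟨⟨l, hl⟩, ?_⟩
      rw [← hp w, ← e, map_add, LinearMap.mem_ker.1 hn, add_zero]
      rfl
  have hcompl : ∀ {L N : Submodule k V} {p : V →ₗ[k] L₂}, IsCompl L N → IsCompl L₂ N →
      (∀ x : L₂, p x = x) → Function.Injective (p ∘ₗ L.subtype) → IsCompl L (LinearMap.ker p) := by
    intro L N p hc hc₂ hp hi
    have hd := LinearMap.isCompl_of_proj hp
    refine (Submodule.isCompl_iff_disjoint _ _ ?_).2 (Submodule.disjoint_def.2 fun v hv hv' => ?_)
    · have h1 := Submodule.finrank_add_eq_of_isCompl hc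
      have h3 := Submodule.finrank_add_eq_of_isCompl hc₂
      have h4 := Submodule.finrank_add_eq_of_isCompl hd
      omega
    · have := (injective_iff_map_eq_zero _).1 hi ⟨v, hv⟩ hv'
      exact congrArg Subtype.val this
  -- The line `q + c • (r - q)`, read from its end `c = 1`, is `r + (1 - c) • (q - r)`.
  have hfin₁ := finite_not_injective_add_smul (hbij hqk hq hH₁) ((r - q) ∘ₗ L₁.subtype)
  have hfin₃ := (finite_not_injective_add_smul (hbij hrk hr hK₃)
    ((q - r) ∘ₗ L₃.subtype)).preimage (f := fun c : k => 1 - c) sub_right_injective.injOn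
  obtain ⟨c, hc⟩ := (hfin₁.union hfin₃).infinite_compl.nonempty
  simp only [Set.compl_union, Set.mem_inter_iff, Set.mem_compl_iff, Set.mem_ofPred_eq, not_not,
    Set.mem_preimage] at hc
  have hp : ∀ x : L₂, (q + c • (r - q)) x = x := fun x => by simp [hq, hr]
  refine ⟨LinearMap.ker (q + c • (r - q)), orthogonal_ker_eq h2 hs hn hL₂ hp fun v => ?_,
    hcompl hH₁ hH₂ hp ?_, hcompl hK₃ hK₂ hp ?_⟩
  · simp only [LinearMap.add_apply, LinearMap.smul_apply, LinearMap.sub_apply, Submodule.coe_add,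
      Submodule.coe_smul, AddSubgroupClass.coe_sub, map_add, map_smul, map_sub, smul_eq_mul]
    linear_combination (1 - c) * hqB v + c * hrB v
  · exact hc.1
  · have e : (q + c • (r - q)) ∘ₗ L₃.subtype =
        r ∘ₗ L₃.subtype + (1 - c) • (q - r) ∘ₗ L₃.subtype := by
      ext v
      simp only [LinearMap.comp_apply, LinearMap.add_apply, LinearMap.smul_apply,
        LinearMap.sub_apply, Submodule.coe_add, Submodule.coe_smul, AddSubgroupClass.coe_sub]
      module
    rw [e]
    exact hc.2

end Lagrangian

/-! ### Cotangent vectors, products and differentials -/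

section Spaces

variable {k : Type*} [Field k] {X Y Z : Type*} [TopologicalSpace X] [RegularFunctions k X]
  [TopologicalSpace Y] [RegularFunctions k Y] [TopologicalSpace Z] [RegularFunctions k Z]

/-- The differentials of the regular functions exhaust the cotangent space: they separate tangent
vectors, and the tangent space is finite-dimensional. -/
theorem exists_diffAt_eq (x : X) [FiniteDimensional k (TangentSpace k x)]
    (β : Module.Dual k (TangentSpace k x)) : ∃ f ∈ regAt k x, diffAt x f = β := by
  let W : Submodule k (Module.Dual k (TangentSpace k x)) :=
    { carrier := {β | ∃ f ∈ regAt k x, diffAt x f = β}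
      add_mem' := by
        rintro _ _ ⟨f, hf, rfl⟩ ⟨g, hg, rfl⟩
        exact ⟨f + g, add_mem hf hg, LinearMap.ext fun v => tangent_add v hf hg⟩
      zero_mem' := ⟨0, zero_mem _, LinearMap.ext fun v => tangent_const v 0⟩
      smul_mem' := by
        rintro c _ ⟨f, hf, rfl⟩
        exact ⟨c • f, Subalgebra.smul_mem _ hf c, LinearMap.ext fun v => tangent_smul v c hf⟩ }
  have hW : W.dualCoannihilator = ⊥ := by
    refine (Submodule.eq_bot_iff _).2 fun v hv => tangent_ext fun f hf => ?_
    exact (Submodule.mem_dualCoannihilator v).1 hv _ ⟨f, hf, rfl⟩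
  have hT : W = ⊤ := by
    rw [← Subspace.dualCoannihilator_dualAnnihilator_eq (W := W), hW,
      Submodule.dualAnnihilator_bot]
  exact (hT ▸ Submodule.mem_top : β ∈ W)

theorem boxAlg_swap {U : Set X} {V : Set Y} {F : X × Y → k} (hF : F ∈ boxAlg k U V) :
    (fun p : Y × X => F (p.2, p.1)) ∈ boxAlg k V U := by
  induction hF using Algebra.adjoin_induction with
  | mem F hF =>
    rcases hF with ⟨u, hu, rfl⟩ | ⟨v, hv, rfl⟩
    · exact Algebra.subset_adjoin (Or.inr ⟨u, hu, rfl⟩)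
    · exact Algebra.subset_adjoin (Or.inl ⟨v, hv, rfl⟩)
  | algebraMap c => exact Subalgebra.algebraMap_mem (boxAlg k V U) c
  | add F G _ _ h1 h2 => exact add_mem h1 h2
  | mul F G _ _ h1 h2 => exact mul_mem h1 h2

theorem ProdRegAt.swap {F : X × Y → k} {x : X} {y : Y} (hF : ProdRegAt k (x, y) F) :
    ProdRegAt k (y, x) fun p : Y × X => F (p.2, p.1) := by
  obtain ⟨U, V, a, b, hU, hV, hx, hy, ha, hb, hb0, hab⟩ := hF
  exact ⟨V, U, _, _, hV, hU, hy, hx, boxAlg_swap ha, boxAlg_swap hb, hb0,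
    fun q h1 h2 h3 => hab (q.2, q.1) h2 h1 h3⟩

theorem tangentMap_tangentMap {ψ : Y → Z} {φ : X → Y} (hψ : IsMorphism k ψ) (hφ : IsMorphism k φ)
    {x : X} {y : Y} {z : Z} (hx : φ x = y) (hy : ψ y = z) (v : TangentSpace k x) :
    tangentMap hψ hy (tangentMap hφ hx v) =
      tangentMap (hψ.comp hφ) (show ψ (φ x) = z by rw [hx, hy]) v := by
  subst hx hy
  refine tangent_ext fun f hf => ?_
  rw [tangentMap_apply _ _ _ hf, tangentMap_apply _ _ _ (hψ.comp_mem _ f hf),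
    tangentMap_apply _ _ _ hf]
  rfl

theorem tangentMap_of_eq_id {φ : X → X} (hφ : IsMorphism k φ) (h : φ = id) {x : X} (hx : φ x = x)
    (v : TangentSpace k x) : tangentMap hφ hx v = v := by
  subst h
  exact tangent_ext fun f hf => tangentMap_apply _ _ _ hf

theorem tangentMap_congr {φ ψ : X → Y} (hφ : IsMorphism k φ) (hψ : IsMorphism k ψ) (h : φ = ψ)
    {x : X} {y : Y} (hx : φ x = y) (hx' : ψ x = y) (v : TangentSpace k x) :
    tangentMap hφ hx v = tangentMap hψ hx' v := by
  subst h
  rfl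

end Spaces

/-! ### Infinitesimal actions -/

section Actions

variable {k : Type*} [Field k]
variable {D Q : Type*} [Group D] [TopologicalSpace D] [RegularFunctions k D]
  [TopologicalSpace Q] [RegularFunctions k Q] [MulAction D Q] [IsAlgAction k D Q]

theorem infAction_apply (s : Q) (v : LieAlg k D) {f : Q → k} (hf : f ∈ regAt k s) :
    (infAction s v).1 f = -v.1 fun d => f (d • s) := by
  change -(tangentMap (isMorphism_orbit k D s) (one_smul D s) v).1 f = _
  rw [tangentMap_apply _ _ _ hf]
  rfl

/-- The infinitesimal action preserves the structure sheaf. -/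
theorem infAction_mem_regAt {s : Q} (v : LieAlg k D) {f : Q → k} (hf : f ∈ regAt k s) :
    (fun y => (infAction y v).1 f) ∈ regAt k s := by
  let _ := prodTopology k D Q
  let _ : RegularFunctions k (VProd D Q) := prodRegularFunctions k
  have h : ProdRegAt k ((1, s) : D × Q) (f ∘ fun p : D × Q => p.1 • p.2) :=
    (IsAlgAction.smul_morphism (k := k) (G := D) (X := Q)).comp_mem (1, s) f (by simpa using hf)
  refine regAt_congr (neg_mem (prodRegAt_deriv h.swap v)) ?_
  filter_upwards [RegularFunctions.eventually_reg hf] with y hy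
  exact (infAction_apply y v hy).symm

variable (k Q) in
theorem isMorphism_smul (d : D) : IsMorphism k fun s : Q => d • s :=
  isMorphism_slice_right (IsAlgAction.smul_morphism (k := k) (G := D) (X := Q)) d

theorem tangentMap_smul_inv_smul (d : D) (s : Q) (v : TangentSpace k s) :
    tangentMap (isMorphism_smul k Q d⁻¹) (inv_smul_smul d s)
      (tangentMap (isMorphism_smul k Q d) (rfl : d • s = d • s) v) = v := by
  rw [tangentMap_tangentMap, tangentMap_of_eq_id]
  exact funext fun s => inv_smul_smul d s

theorem tangentMap_smul_smul_inv (d : D) (s : Q) (v : TangentSpace k (d • s)) :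
    tangentMap (isMorphism_smul k Q d) (rfl : d • s = d • s)
      (tangentMap (isMorphism_smul k Q d⁻¹) (inv_smul_smul d s) v) = v := by
  rw [tangentMap_tangentMap, tangentMap_of_eq_id]
  exact funext fun s => smul_inv_smul d s

/-- Where the infinitesimal stabilizers have constant dimension, transversality of a subspace to the
infinitesimal stabilizer is an open condition: it amounts to a determinant, regular in the point,
being nonzero. -/
theorem isOpen_setOf_isCompl_ker_infAction [IsVariety k D] [IsVariety k Q]
    {n : ℕ} (hker : ∀ s : Q,
      Module.finrank k (LinearMap.ker (infAction (k := k) (G := D) s)) = n)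
    (H : Submodule k (LieAlg k D)) :
    IsOpen {s : Q | IsCompl (LinearMap.ker (infAction (k := k) (G := D) s)) H} := by
  refine isOpen_iff_mem_nhds.2 fun s hs => ?_
  have hs : IsCompl (LinearMap.ker (infAction (k := k) (G := D) s)) H := hs
  have : Module.Free k H := Module.Free.of_divisionRing k H
  let b := Module.finBasis k H
  let A : H →ₗ[k] TangentSpace k s := infAction s ∘ₗ H.subtype
  have hA : Function.Injective A := (injective_iff_map_eq_zero _).2 fun v hv =>
    Subtype.ext (Submodule.disjoint_def.1 hs.disjoint (v : LieAlg k D) hv v.2 :)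
  -- Functions whose differentials at `s` restrict to the basis of the dual of `H` dual to `b`.
  have hf : ∀ i, ∃ f ∈ regAt k s, ∀ v : H, (infAction s (v : LieAlg k D)).1 f = b.coord i v := by
    intro i
    obtain ⟨β, hβ⟩ := LinearMap.dualMap_surjective_of_injective (V₁ := H)
      (V₂ := TangentSpace k s) (f := A) hA (b.coord i)
    obtain ⟨f, hf, e⟩ := exists_diffAt_eq s β
    refine ⟨f, hf, fun v => ?_⟩
    rw [← hβ, ← e]
    rfl
  choose f hf hfv using hf
  let N : Q → Matrix (Fin (Module.finrank k H)) (Fin (Module.finrank k H)) k :=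
    fun y => Matrix.of fun i j => (infAction y (b j : LieAlg k D)).1 (f i)
  have hN : N s = 1 := by
    ext i j
    simp [N, hfv, Matrix.one_apply, Finsupp.single_apply, eq_comm]
  have hdet : (fun y => (N y).det) ∈ regAt k s := by
    have e : (fun y => (N y).det) = ∑ σ : Equiv.Perm (Fin (Module.finrank k H)),
        (Equiv.Perm.sign σ : ℤ) • ∏ i, fun y => (infAction y (b i : LieAlg k D)).1 (f (σ i)) := by
      ext y
      simp [Matrix.det_apply, N, Units.smul_def]
    rw [e]
    exact sum_mem fun σ _ => zsmul_mem (prod_mem fun i _ => infAction_mem_regAt _ (hf _)) _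
  filter_upwards [RegularFunctions.eventually_ne hdet (by simp [hN])] with y hy
  refine (Submodule.isCompl_iff_disjoint _ _ ?_).2 (Submodule.disjoint_def.2 fun v hv hvH => ?_)
  · rw [hker y, ← hker s, Submodule.finrank_add_eq_of_isCompl hs]
  · have h0 : (N y).mulVec (b.repr ⟨v, hvH⟩) = 0 := by
      ext i
      have e : ∑ j, b.repr ⟨v, hvH⟩ j • (b j : LieAlg k D) = v := by
        have := congrArg H.subtype (b.sum_repr ⟨v, hvH⟩)
        simp only [map_sum, map_smul] at this
        exact this
      have h1 : diffAt y (f i) (infAction y v) = 0 := by rw [LinearMap.mem_ker.1 hv, map_zero]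
      rw [← e, map_sum, map_sum] at h1
      simp only [map_smul, smul_eq_mul] at h1
      refine (Finset.sum_congr rfl fun j _ => ?_).trans h1
      exact mul_comm _ _
    have h1 : b.repr ⟨v, hvH⟩ = 0 :=
      DFunLike.coe_injective (Matrix.eq_zero_of_mulVec_eq_zero hy h0)
    exact congrArg Subtype.val (b.repr.map_eq_zero_iff.1 h1)

end Actions

/-! ### Admissible complements on the quotient `D/G` -/

section Homogeneous

variable {k : Type*} [Field k]
variable {D : Type*} [Group D] [TopologicalSpace D] [RegularFunctions k D] [IsAlgGroup k D]
  {Q : Type*} [TopologicalSpace Q] [RegularFunctions k Q] [MulAction D Q] [IsAlgAction k D Q]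

theorem Ad_apply_Ad_inv (d : D) (v : LieAlg k D) : Ad d (Ad d⁻¹ v) = v := by
  rw [Ad, Ad, tangentMap_tangentMap, tangentMap_of_eq_id]
  exact funext fun x => by simp [mul_assoc]

theorem Ad_inv_apply_Ad (d : D) (v : LieAlg k D) : Ad d⁻¹ (Ad d v) = v := by
  simpa using Ad_apply_Ad_inv d⁻¹ v

/-- The infinitesimal action is `D`-equivariant. -/
theorem infAction_smul_Ad (d : D) (s : Q) (v : LieAlg k D) :
    infAction (d • s) (Ad d v) =
      tangentMap (isMorphism_smul k Q d) (rfl : d • s = d • s) (infAction s v) := by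
  change -tangentMap _ _ _ = tangentMap _ _ (-tangentMap _ _ _)
  rw [map_neg, Ad, tangentMap_tangentMap, tangentMap_tangentMap]
  congr 1
  refine tangentMap_congr _ _ (funext fun x => ?_) _ _ v
  simp [mul_smul]

theorem ker_infAction_smul (d : D) (s : Q) :
    LinearMap.ker (infAction (k := k) (d • s)) =
      (LinearMap.ker (infAction (k := k) (G := D) s)).map (Ad d) := by
  ext v
  constructor
  · intro hv
    refine ⟨Ad d⁻¹ v, ?_, Ad_apply_Ad_inv d v⟩
    rw [SetLike.mem_coe, LinearMap.mem_ker, ← tangentMap_smul_inv_smul d s (infAction s (Ad d⁻¹ v)),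
      ← infAction_smul_Ad, Ad_apply_Ad_inv, LinearMap.mem_ker.1 hv, map_zero]
  · rintro ⟨w, hw, rfl⟩
    rw [LinearMap.mem_ker, infAction_smul_Ad, LinearMap.mem_ker.1 hw, map_zero]

variable {P : GroupPair k D} {o : Q}

theorem IsQuotient.surjective_infAction (hQ : IsQuotient (k := k) P.G o) (s : Q) :
    Function.Surjective (infAction (k := k) (G := D) s) := by
  obtain ⟨d, rfl⟩ := hQ.transitive s
  intro w
  obtain ⟨v, hv⟩ := hQ.smooth (tangentMap (isMorphism_smul k Q d⁻¹) (inv_smul_smul d o) w)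
  exact ⟨Ad d v, by rw [infAction_smul_Ad, hv, tangentMap_smul_smul_inv]⟩

theorem IsQuotient.orthogonal_ker_infAction (hQ : IsQuotient (k := k) P.G o) (s : Q) :
    P.form.orthogonal (LinearMap.ker (infAction (k := k) (G := D) s)) =
      LinearMap.ker (infAction (k := k) (G := D) s) := by
  obtain ⟨d, rfl⟩ := hQ.transitive s
  rw [ker_infAction_smul, hQ.lie_stabilizer]
  ext w
  constructor
  · refine fun hw => ⟨Ad d⁻¹ w, ?_, Ad_apply_Ad_inv d w⟩
    rw [← P.lagrangian]
    intro v hv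
    rw [← P.invariant d, Ad_apply_Ad_inv]
    exact hw _ ⟨v, hv, rfl⟩
  · rintro ⟨w, hw, rfl⟩ _ ⟨v, hv, rfl⟩
    rw [P.invariant]
    exact (P.lagrangian.symm ▸ hw : w ∈ P.form.orthogonal _) v hv

theorem IsQuotient.finrank_ker_infAction (hQ : IsQuotient (k := k) P.G o) (s : Q) :
    Module.finrank k (LinearMap.ker (infAction (k := k) (G := D) s)) =
      Module.finrank k (LinearMap.range (lieIncl (k := k) P.G)) := by
  obtain ⟨d, rfl⟩ := hQ.transitive s
  rw [ker_infAction_smul, hQ.lie_stabilizer]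
  exact (Submodule.equivMapOfInjective (Ad d)
    (Function.LeftInverse.injective (Ad_inv_apply_Ad d)) _).finrank_eq.symm

theorem IsQuotient.isOpen_setOf_isCompl (hQ : IsQuotient (k := k) P.G o) [IsVariety k Q]
    (H : Submodule k (LieAlg k D)) :
    IsOpen {s : Q | IsCompl (LinearMap.ker (infAction (k := k) (G := D) s)) H} :=
  isOpen_setOf_isCompl_ker_infAction hQ.finrank_ker_infAction H

theorem isAdmissible_iff {s : Q} (hsurj : Function.Surjective (infAction (k := k) (G := D) s))
    (h : LagrangianComplement P) :
    IsAdmissible h s ↔ IsCompl (LinearMap.ker (infAction (k := k) (G := D) s)) h.space := by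
  constructor
  · intro ha
    refine ⟨Submodule.disjoint_def.2 fun v hv hv' => ?_, codisjoint_iff.2 (eq_top_iff.2 fun v _ => ?_)⟩
    · exact congrArg Subtype.val ((injective_iff_map_eq_zero _).1 ha.1 ⟨v, hv'⟩ hv)
    · obtain ⟨w, hw⟩ := ha.2 (infAction s v)
      refine Submodule.mem_sup.2 ⟨v - w, ?_, w, w.2, sub_add_cancel _ _⟩
      rw [LinearMap.mem_ker, map_sub, ← hw]
      exact sub_self _
  · intro hc
    refine ⟨(injective_iff_map_eq_zero _).2 fun v hv =>
      Subtype.ext (Submodule.disjoint_def.1 hc.disjoint (v : LieAlg k D) hv v.2 :), fun w => ?_⟩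
    obtain ⟨v, rfl⟩ := hsurj w
    obtain ⟨a, ha, b, hb, rfl⟩ := Submodule.mem_sup.1
      (hc.sup_eq_top ▸ Submodule.mem_top : v ∈ _ ⊔ h.space)
    refine ⟨⟨b, hb⟩, ?_⟩
    rw [map_add, LinearMap.mem_ker.1 ha, zero_add]
    rfl

/-- Every point of an irreducible quotient `D/G` has an admissible Lagrangian complement.  The open
sets of points at which a complement of the Lie algebra of `G`, respectively a complement of the
infinitesimal stabilizer of `s`, is transversal to the infinitesimal stabilizer meet at some `s'`.
Thus the stabilizer of `s'` shares Lagrangian complements with both others. -/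
theorem IsQuotient.exists_isAdmissible [Infinite k] (h2 : (2 : k) ≠ 0)
    (hQ : IsQuotient (k := k) P.G o) [IsVariety k Q] [IrreducibleSpace Q] (s : Q) :
    ∃ h : LagrangianComplement P, IsAdmissible h s := by
  obtain ⟨H, hH, hHc⟩ := exists_lagrangian_complement h2 P.symm P.nondegenerate P.lagrangian
  obtain ⟨K, hK, hKc⟩ := exists_lagrangian_complement h2 P.symm P.nondegenerate
    (hQ.orthogonal_ker_infAction s)
  obtain ⟨s', hs'H, hs'K⟩ := nonempty_preirreducible_inter (hQ.isOpen_setOf_isCompl H)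
    (hQ.isOpen_setOf_isCompl K) ⟨o, by rwa [Set.mem_ofPred_eq, hQ.lie_stabilizer]⟩ ⟨s, hKc⟩
  obtain ⟨M, hM, hM1, hM2⟩ := exists_common_lagrangian_complement h2 P.symm P.nondegenerate
    (hQ.orthogonal_ker_infAction s') hH hK hHc hs'H hs'K hKc
  exact ⟨⟨M, hM, hM1⟩, (isAdmissible_iff (hQ.surjective_infAction s) _).2 hM2⟩

end Homogeneous

/-! ### Projections and twists of a group pair -/

section Pair

variable {k : Type*} [Field k]
variable {D : Type*} [Group D] [TopologicalSpace D] [RegularFunctions k D] [IsAlgGroup k D]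
  {P : GroupPair k D}

namespace GroupPair

theorem form_dualIso (ξ : Module.Dual k (LieAlg k D)) (v : LieAlg k D) :
    P.form (P.dualIso ξ) v = ξ v :=
  LinearMap.BilinForm.apply_toDual_symm_apply ..

theorem proj_lieIncl (h : LagrangianComplement P) (x : LieAlg k P.G) :
    P.proj h (lieIncl P.G x) = x :=
  LinearMap.linearProjOfIsCompl_apply_left ..

theorem proj_eq_zero (h : LagrangianComplement P) {y : LieAlg k D} (hy : y ∈ h.space) :
    P.proj h y = 0 :=
  LinearMap.linearProjOfIsCompl_apply_right' _ _ _ _ y hy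

theorem sub_lieIncl_proj_mem (h : LagrangianComplement P) (v : LieAlg k D) :
    v - lieIncl P.G (P.proj h v) ∈ h.space := by
  have hv : v ∈ LinearMap.range (lieIncl (k := k) P.G) ⊔ h.space :=
    h.isCompl.sup_eq_top ▸ Submodule.mem_top
  obtain ⟨_, ⟨x, rfl⟩, y, hy, rfl⟩ := Submodule.mem_sup.1 hv
  rwa [map_add, proj_lieIncl, proj_eq_zero h hy, add_zero, add_sub_cancel_left]

theorem form_eq_zero_of_mem (h : LagrangianComplement P) {y z : LieAlg k D} (hy : y ∈ h.space)
    (hz : z ∈ h.space) : P.form y z = 0 :=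
  (h.lagrangian.symm ▸ hz : z ∈ P.form.orthogonal h.space) y hy

theorem form_lieIncl_lieIncl (x y : LieAlg k P.G) :
    P.form (lieIncl P.G x) (lieIncl P.G y) = 0 :=
  (P.lagrangian.ge (LinearMap.mem_range_self _ y)) _ (LinearMap.mem_range_self _ x)

theorem form_self_eq (h : LagrangianComplement P) (v : LieAlg k D) :
    P.form v v = 2 * P.form v (lieIncl P.G (P.proj h v)) := by
  have e1 := form_eq_zero_of_mem h (sub_lieIncl_proj_mem h v) (sub_lieIncl_proj_mem h v)
  have e2 := form_lieIncl_lieIncl (P.proj h v) (P.proj h v)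
  simp only [map_sub, LinearMap.sub_apply, e2, P.symm.eq (lieIncl P.G (P.proj h v)) v] at e1
  linear_combination e1

/-- `p_h η` is the element of `𝔤` representing the restriction of `η` to `h`. -/
theorem p_eq_iff (h : LagrangianComplement P) (η : Module.Dual k (LieAlg k D))
    (x : LieAlg k P.G) :
    P.p h η = x ↔ ∀ y ∈ h.space, η y = P.form (lieIncl P.G x) y := by
  constructor
  · rintro rfl y hy
    have e := form_eq_zero_of_mem h (sub_lieIncl_proj_mem h (P.dualIso η)) hy
    rw [map_sub, LinearMap.sub_apply, form_dualIso] at e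
    exact sub_eq_zero.1 e
  · intro hx
    have hm : P.dualIso η - lieIncl P.G x ∈ h.space := by
      rw [← h.lagrangian]
      intro y hy
      rw [P.symm.eq, map_sub, LinearMap.sub_apply, form_dualIso, hx y hy, sub_self]
    have e := proj_eq_zero h hm
    rw [map_sub, proj_lieIncl] at e
    exact sub_eq_zero.1 e

/-- A covector annihilating `𝔤` corresponds to an element of `𝔤`, on which all the projections
agree. -/
theorem p_eq_p_of_dualMap_eq_zero (h₁ h₂ : LagrangianComplement P)
    {η : Module.Dual k (LieAlg k D)} (hη : (lieIncl P.G).dualMap η = 0) :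
    P.p h₁ η = P.p h₂ η := by
  have hm : P.dualIso η ∈ LinearMap.range (lieIncl (k := k) P.G) := by
    rw [← P.lagrangian]
    rintro _ ⟨x, rfl⟩
    rw [P.symm.eq, form_dualIso]
    exact LinearMap.congr_fun hη x
  obtain ⟨x, hx⟩ := hm
  change P.proj h₁ (P.dualIso η) = P.proj h₂ (P.dualIso η)
  rw [← hx, proj_lieIncl, proj_lieIncl]

theorem exists_isTwist (h2 : (2 : k) ≠ 0) (h₁ h₂ : LagrangianComplement P) :
    ∃ t : LinearMap.BilinForm k (Module.Dual k (LieAlg k P.G)), P.IsTwist h₁ h₂ t := by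
  let T : Module.Dual k (LieAlg k P.G) →ₗ[k] LieAlg k P.G :=
    (P.p h₁ - P.p h₂) ∘ₗ (P.proj h₁).dualMap
  refine ⟨Module.Dual.eval k (LieAlg k P.G) ∘ₗ T, fun α => ?_, fun ξ β => ?_⟩
  · -- Both projections of `v` pair with `v` to half of its square.
    set v := P.dualIso ((P.proj h₁).dualMap α) with hv
    have e : ∀ h, α (P.p h ((P.proj h₁).dualMap α)) = P.form v (lieIncl P.G (P.proj h v)) := by
      intro h
      rw [hv, form_dualIso, LinearMap.dualMap_apply, proj_lieIncl]
      rfl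
    change α (P.p h₁ _ - P.p h₂ _) = 0
    rw [map_sub, e, e]
    refine (mul_eq_zero.1 (?_ : (2 : k) * _ = 0)).resolve_left h2
    linear_combination form_self_eq h₂ v - form_self_eq h₁ v
  · have h0 : (lieIncl P.G).dualMap (ξ - (P.proj h₁).dualMap ((lieIncl P.G).dualMap ξ)) = 0 := by
      ext x
      simp [LinearMap.dualMap_apply, proj_lieIncl]
    have e := p_eq_p_of_dualMap_eq_zero h₁ h₂ h0
    rw [map_sub, map_sub] at e
    change _ = -β (P.p h₁ _ - P.p h₂ _)
    rw [← map_neg, ← map_sub]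
    congr 1
    rw [sub_eq_sub_iff_add_eq_add] at e
    rw [neg_sub, sub_eq_sub_iff_add_eq_add]
    exact e.symm.trans (add_comm _ _)

end GroupPair

end Pair

/-! ### Moment maps -/

section Moment

variable {k : Type*} [Field k]
variable {D : Type*} [Group D] [TopologicalSpace D] [RegularFunctions k D] [IsAlgGroup k D]
  {P : GroupPair k D}
  {Q : Type*} [TopologicalSpace Q] [RegularFunctions k Q] [MulAction D Q] [IsAlgAction k D Q]
  {X : Type*} [TopologicalSpace X] [RegularFunctions k X] [MulAction P.G X] [IsAlgAction k P.G X]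

/-- The moment map condition at the point `x` for the complement `h`, in coordinate-free form: with
`η` the covector `v ↦ ã(v).f₁` on `𝔡`, the bracket of `μ^* f₁` and `f₂` is `a(p_h η).f₂`. -/
def IsMomentMapAt (S : QuasiPoissonStructure P X) (h : LagrangianComplement P) (μ : X → Q)
    (x : X) : Prop :=
  ∀ f₁ ∈ regAt k (μ x), ∀ f₂ ∈ regAt k x,
    (S.π h).br (f₁ ∘ μ) f₂ x =
      (infAction x (P.p h ((infAction (G := D) (μ x)).dualMap (diffAt (μ x) f₁)))).1 f₂

theorem sum_infAction_mul_infAction (h : LagrangianComplement P) {n : ℕ}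
    (e : Module.Basis (Fin n) k (LieAlg k D)) (s : Q) (x : X) (f₁ : Q → k) (f₂ : X → k) :
    ∑ i, (infAction s (e i)).1 f₁ * (infAction x (P.p h (e.dualBasis i))).1 f₂ =
      (infAction x (P.p h ((infAction (G := D) s).dualMap (diffAt s f₁)))).1 f₂ := by
  have e1 := e.sum_dual_apply_smul_coord ((infAction (G := D) s).dualMap (diffAt s f₁))
  have e2 : ∀ η, (infAction x (P.p h η)).1 f₂ = diffAt x f₂ (infAction x (P.p h η)) :=
    fun _ => rfl
  simp only [e2]
  rw [← e1]
  simp only [map_sum, map_smul, smul_eq_mul, Module.Basis.coe_dualBasis]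
  rfl

theorem infAction_comp_apply {μ : X → Q} (hμ : IsMorphism k μ)
    (hequiv : ∀ (g : P.G) (x : X), μ (g • x) = (g : D) • μ x) (x : X) (v : LieAlg k P.G)
    {f : Q → k} (hf : f ∈ regAt k (μ x)) :
    (infAction x v).1 (f ∘ μ) = (infAction (μ x) (lieIncl P.G v)).1 f := by
  have hr : (fun d : D => f (d • μ x)) ∈ regAt k (1 : D) :=
    (isMorphism_orbit k D (μ x)).comp_mem 1 f (by simpa using hf)
  rw [infAction_apply _ _ (hμ.comp_mem x f hf), infAction_apply _ _ hf, lieIncl,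
    tangentMap_apply _ _ _ hr]
  simp only [Function.comp_def, hequiv]

/-- The moment map condition does not depend on the complement: by equivariance of `μ`, a twist
changes both sides by the same amount. -/
theorem IsMomentMapAt.of_complement (h2 : (2 : k) ≠ 0) {S : QuasiPoissonStructure P X} {μ : X → Q}
    (hμ : IsMorphism k μ) (hequiv : ∀ (g : P.G) (x : X), μ (g • x) = (g : D) • μ x)
    {h₁ : LagrangianComplement P} {x : X} (H : IsMomentMapAt S h₁ μ x)
    (h₂ : LagrangianComplement P) : IsMomentMapAt S h₂ μ x := by
  intro f₁ hf₁ f₂ hf₂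
  obtain ⟨t, ht⟩ := GroupPair.exists_isTwist h2 h₁ h₂
  have e : infCovector P x (f₁ ∘ μ) =
      (lieIncl P.G).dualMap ((infAction (G := D) (μ x)).dualMap (diffAt (μ x) f₁)) :=
    LinearMap.ext fun v => infAction_comp_apply hμ hequiv x v hf₁
  have e2 := ht.2 ((infAction (G := D) (μ x)).dualMap (diffAt (μ x) f₁)) (infCovector P x f₂)
  rw [S.twist h₁ h₂ t ht x _ (hμ.comp_mem x f₁ hf₁) f₂ hf₂, H f₁ hf₁ f₂ hf₂, e]
  rw [sub_eq_iff_eq_add, neg_add_eq_sub] at e2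
  exact e2.symm

/-- Both sides say that the covector `v ↦ β(ã(v))` agrees with `c(ξ, ·)` on `h`. -/
theorem eq_theta_iff (h : LagrangianComplement P) {s : Q} (hs : IsAdmissible h s)
    (β : Module.Dual k (TangentSpace k s)) (ξ : LieAlg k P.G) :
    β = theta h hs ξ ↔ P.p h ((infAction (G := D) s).dualMap β) = ξ := by
  have hθ : ∀ y : h.space, theta h hs ξ (infAction s (y : LieAlg k D)) =
      P.form (lieIncl P.G ξ) y := fun y => by
    have : (LinearEquiv.ofBijective (complAction h s) hs).symm (infAction s (y : LieAlg k D)) = y :=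
      LinearEquiv.ofBijective_symm_apply_apply (complAction h s) y
    change P.form (lieIncl P.G ξ) ((LinearEquiv.ofBijective (complAction h s) hs).symm _) = _
    rw [this]
  rw [GroupPair.p_eq_iff]
  constructor
  · rintro rfl y hy
    exact hθ ⟨y, hy⟩
  · intro H
    refine LinearMap.ext fun w => ?_
    obtain ⟨y, rfl⟩ := hs.2 w
    exact (H y y.2).trans (hθ y).symm

theorem dualMap_tangentMap_diffAt {μ : X → Q} (hμ : IsMorphism k μ) (x : X) {f : Q → k}
    (hf : f ∈ regAt k (μ x)) :
    (tangentMap hμ (rfl : μ x = μ x)).dualMap (diffAt (μ x) f) = diffAt x (f ∘ μ) :=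
  LinearMap.ext fun v => tangentMap_apply hμ rfl v hf

/-- At a point where `h` is admissible, the two moment map conditions for `h` say the same: `df₁` is
the covector `⟨θ^h, ξ⟩` precisely for `ξ = p_h η`, with `η` the covector `v ↦ ã(v).f₁`. -/
theorem isMomentMapAt_iff [IsVariety k Q] (S : QuasiPoissonStructure P X) {μ : X → Q}
    (hμ : IsMorphism k μ) (h : LagrangianComplement P) (x : X) (hx : IsAdmissible h (μ x)) :
    IsMomentMapAt S h μ x ↔ ∀ ξ : LieAlg k P.G,
      infAction x ξ = (S.π h).sharp x ((tangentMap hμ rfl).dualMap (theta h hx ξ)) := by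
  constructor
  · intro H ξ
    obtain ⟨f₁, hf₁, e⟩ := exists_diffAt_eq (μ x) (theta h hx ξ)
    refine tangent_ext fun f₂ hf₂ => ?_
    rw [← e, dualMap_tangentMap_diffAt hμ x hf₁,
      Bivector.sharp_diffAt _ _ hf₂ (hμ.comp_mem x f₁ hf₁), H f₁ hf₁ f₂ hf₂,
      (eq_theta_iff h hx _ ξ).1 e]
  · intro H f₁ hf₁ f₂ hf₂
    rw [H, ← (eq_theta_iff h hx (diffAt (μ x) f₁) _).2 rfl, dualMap_tangentMap_diffAt hμ x hf₁,
      Bivector.sharp_diffAt _ _ hf₂ (hμ.comp_mem x f₁ hf₁)]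

end Moment

end QuasiPoisson

theorem mainTheorem9 {k : Type*} [Field k] [IsAlgClosed k] (hk : (2 : k) ≠ 0)
    {D : Type*} [Group D] [TopologicalSpace D] [RegularFunctions k D] [IsAlgGroup k D]
    (P : GroupPair k D)
    {Q : Type*} [TopologicalSpace Q] [RegularFunctions k Q] [IsVariety k Q]
    [MulAction D Q] [IsAlgAction k D Q] (o : Q) (hQ : IsQuotient (k := k) P.G o)
    [IrreducibleSpace Q]
    {X : Type*} [TopologicalSpace X] [RegularFunctions k X] [IsVariety k X]
    [MulAction P.G X] [IsAlgAction k P.G X] (S : QuasiPoissonStructure P X)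
    (μ : X → Q) (hμ : IsMorphism k μ)
    (hequiv : ∀ (g : P.G) (x : X), μ (g • x) = (g : D) • μ x) :
    IsMomentMap S μ ↔ IsAKSMomentMap S hμ := by
  have : Infinite k := IsAlgClosed.instInfinite
  constructor
  · rintro ⟨h₀, H⟩ U _ h hU x hx
    refine (isMomentMapAt_iff S hμ h x (hU _ hx)).1
      (IsMomentMapAt.of_complement hk hμ hequiv (h₁ := h₀) (fun f₁ hf₁ f₂ hf₂ => ?_) h)
    have : Module.Free k (LieAlg k D) := Module.Free.of_divisionRing k _
    rw [H _ (Module.finBasis k (LieAlg k D)) x f₁ hf₁ f₂ hf₂, sum_infAction_mul_infAction]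
  · intro H
    obtain ⟨h₀, -⟩ := hQ.exists_isAdmissible hk o
    refine ⟨h₀, fun n e x f₁ hf₁ f₂ hf₂ => ?_⟩
    rw [sum_infAction_mul_infAction]
    obtain ⟨h, hh⟩ := hQ.exists_isAdmissible hk (μ x)
    have hadm : ∀ s : Q, IsAdmissible h s ↔ _ := fun s =>
      isAdmissible_iff (hQ.surjective_infAction s) h
    refine IsMomentMapAt.of_complement hk hμ hequiv ((isMomentMapAt_iff S hμ h x hh).2 ?_) h₀
      f₁ hf₁ f₂ hf₂
    exact H _ (hQ.isOpen_setOf_isCompl h.space) h (fun s hs => (hadm s).2 hs) x ((hadm _).1 hh)
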